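/- Fix an integer $d\ge 1$. Let $Z_1,\dots,Z_d$ be sequences (pools) of random variables $Z_i(r)$, $r\ge 1$, all mutually independent and uniform on the set of bins $[n]=\{1,\dots,n\}$. Balls are allocated one after the other. For each ball, for $i=1,2,\dots$, the next unused element of the pool $Z_i$ is offered as its $i$-ary allocation and is either accepted (it is then the final allocation of the ball) or rejected (then the $(i+1)$-ary allocation is offered); the $d$-ary allocation is always accepted. A $d$-thinning strategy $f$ decides whether the $i$-ary allocation of the $t$-th ball is accepted, for $i<d$, as a function of the final allocations of the first $t-1$ balls, of the offered bin, and of external, possibly random, data; these data may depend on the past but, jointly with all offers made so far, they must be independent of all future allocations, that is, of the pool elements not yet offered. Let $\mathrm{MaxLoad}^f(t)$ be the maximum, over the $n$ bins, of the number of the first $t$ balls finally allocated to the bin, and let $$\ell=\ell(d,n)=\left(\frac{d\log n}{\log\log n}\right)^{1/d}.$$ **Proposition.** Let $d\ge 1$ be an integer and let $\rho>0$. For every $\varepsilon>0$ there is $n_0=n_0(d,\rho,\varepsilon)$ such that for all $n>n_0$ every $d$-thinning strategy $f$ satisfies $$\mathbb P\left(\mathrm{MaxLoad}^f(\lfloor\rho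 n\rfloor)<(d-\varepsilon)\ell\right)<\exp\left(-n^{\varepsilon/(3d)}\right).\qquad(*)$$ Moreover, $\varepsilon$ may depend on $n$: there is an absolute constant $C>0$ such that for all $d\ge1$ and $\rho>0$ there is $n_0=n_0(d,\rho)$ such that $(*)$ holds for all $n>n_0$, all $\varepsilon\ge C/\log\log n$ and every $d$-thinning strategy $f$. Consequently, with high probability the maximum load of any $d$-thinning strategy is at least $(d-o(1))\ell$: for all $d\ge1$, $\rho>0$ and $\delta>0$ there is $n_0=n_0(d,\rho,\delta)$ such that for all $n>n_0$ every $d$-thinning strategy $f$ satisfies $$\mathbb P\left(\mathrm{MaxLoad}^f(\lfloor\rho n\rfloor)\ge\left(d-\frac{C}{\log\log n}\right)\ell\right)>1-\delta.$$ -/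

import Mathlib

open MeasureTheory ProbabilityTheory

universe u v

/-- The discrete σ-algebra on "a bin or nothing". -/
instance Thinning.measurableSpaceOptionFin (n : ℕ) : MeasurableSpace (Option (Fin n)) := ⊤

namespace Thinning

/-! Conventions.  The `n` bins are `Fin n`.  Balls, rounds and pool entries are counted from `0`:
`t : ℕ` is the `(t+1)`-st ball, `i : Fin d` is the `(i+1)`-ary round, and `z i r` is the
`(r+1)`-st entry of the pool of `(i+1)`-ary allocations. -/

/-- A `d`-thinning strategy for `n` bins.  `rejects t i h b x = true` means: when `h` lists the final
allocations of the `t` earlier balls and bin `b` is offered to the current ball in round `i`, then,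
on the external data `x`, the offer is rejected.  The offer of the last round is never rejected. -/
structure Strategy (d n : ℕ) (E : Type v) [MeasurableSpace E] where
  rejects : (t : ℕ) → Fin d → (Fin t → Fin n) → Fin n → E → Bool
  measurable_rejects : ∀ t i h b, Measurable (rejects t i h b)
  last_accepts : ∀ t (i : Fin d) h b x, i.val + 1 = d → rejects t i h b x = false

section Dynamics

variable {d n : ℕ} [NeZero d] {E : Type v} [MeasurableSpace E]

/-- Whether ball `t` would be rejected in round `i`, if it gets there, when `c k` entries of the
pool `k` have been used by the earlier balls, whose final allocations are `h`.
The bin that would be offered is then the next unused entry `z i (c i)` of the pool `i`. -/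
def rejectsAt (f : Strategy d n E) (z : Fin d → ℕ → Fin n) (x : ℕ → Fin d → E)
    (t : ℕ) (c : Fin d → ℕ) (h : Fin t → Fin n) (i : Fin d) : Bool :=
  f.rejects t i h (z i (c i)) (x t i)

lemma exists_accepted (f : Strategy d n E) (z : Fin d → ℕ → Fin n) (x : ℕ → Fin d → E)
    (t : ℕ) (c : Fin d → ℕ) (h : Fin t → Fin n) :
    ∃ i, rejectsAt f z x t c h i = false := by
  have hd : 0 < d := Nat.pos_of_ne_zero (NeZero.ne d)
  exact ⟨⟨d - 1, by omega⟩, f.last_accepts _ _ _ _ _ (by simp only; omega)⟩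

/-- The round in which ball `t` is accepted: the first one whose offer is not rejected. -/
def chosenAt (f : Strategy d n E) (z : Fin d → ℕ → Fin n) (x : ℕ → Fin d → E)
    (t : ℕ) (c : Fin d → ℕ) (h : Fin t → Fin n) : Fin d :=
  Fin.find (fun i => rejectsAt f z x t c h i = false) (exists_accepted f z x t c h)

/-- The state after `t` balls: how many entries of each pool have been used, and the final
allocations.  Ball `t` uses one entry of the pool `i` exactly when all its offers in earlier
rounds are rejected. -/
def run (f : Strategy d n E) (z : Fin d → ℕ → Fin n) (x : ℕ → Fin d → E) :
    (t : ℕ) → (Fin d → ℕ) × (Fin t → Fin n)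
  | 0 => (fun _ => 0, Fin.elim0)
  | t + 1 =>
    let c := (run f z x t).1
    let h := (run f z x t).2
    let j := chosenAt f z x t c h
    (fun i => c i + if ∀ k < i, rejectsAt f z x t c h k = true then 1 else 0,
      Fin.snoc (α := fun _ => Fin n) h (z j (c j)))

/-- The number of entries of the pool `i` used by the first `t` balls, that is, how many of the
first `t` balls have had all their offers before round `i` rejected. -/
def used (f : Strategy d n E) (z : Fin d → ℕ → Fin n) (x : ℕ → Fin d → E) (t : ℕ) (i : Fin d) : ℕ :=
  (run f z x t).1 i

/-- The final allocation of ball `t`. -/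
def alloc (f : Strategy d n E) (z : Fin d → ℕ → Fin n) (x : ℕ → Fin d → E) (t : ℕ) : Fin n :=
  (run f z x (t + 1)).2 (Fin.last t)

/-- The load of bin `m` after `t` balls. -/
def load (f : Strategy d n E) (z : Fin d → ℕ → Fin n) (x : ℕ → Fin d → E) (t : ℕ) (m : Fin n) : ℕ :=
  ((Finset.range t).filter fun k => alloc f z x k = m).card

/-- The maximum load over all bins after `t` balls. -/
def maxLoad (f : Strategy d n E) (z : Fin d → ℕ → Fin n) (x : ℕ → Fin d → E) (t : ℕ) : ℕ :=
  Finset.univ.sup (load f z x t)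

/-- The bin offered to ball `t` in round `i`; `none` if the ball was accepted in an earlier round. -/
def offer (f : Strategy d n E) (z : Fin d → ℕ → Fin n) (x : ℕ → Fin d → E) (t : ℕ) (i : Fin d) :
    Option (Fin n) :=
  if ∀ k < i, rejectsAt f z x t (run f z x t).1 (run f z x t).2 k = true then
    some (z i (used f z x t i)) else none

/-- Everything offered up to and including round `i` of ball `t` (later entries are blanked).
As an offer is made only after a rejection, this also records every decision made so far, other
than the one about the present offer. -/
def past (f : Strategy d n E) (z : Fin d → ℕ → Fin n) (x : ℕ → Fin d → E) (t : ℕ) (i : Fin d) :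
    ℕ → Fin d → Option (Fin n) :=
  fun s j => if s < t ∨ (s = t ∧ j ≤ i) then offer f z x s j else none

/-- The future allocations, seen from round `i` of ball `t`: all the pools, each from its first entry
that has not been used up to and including that round. -/
def future (f : Strategy d n E) (z : Fin d → ℕ → Fin n) (x : ℕ → Fin d → E) (t : ℕ) (i : Fin d) :
    Fin d → ℕ → Fin n :=
  fun k r => z k ((if k ≤ i then used f z x (t + 1) k else used f z x t k) + r)

end Dynamics

/-- A `d`-thinning strategy together with the randomness it runs on: `d` sequences of independent
uniform bins (the pools), and external, possibly random, data for every decision.  The data may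
depend on the past, but at the time of each decision the data used, jointly with everything offered
so far, are independent of all future allocations. -/
structure ThinningProcess (d n : ℕ) [NeZero d] where
  Ω : Type u
  [measurableSpaceΩ : MeasurableSpace Ω]
  P : Measure Ω
  [isProbabilityMeasure : IsProbabilityMeasure P]
  E : Type v
  [measurableSpaceE : MeasurableSpace E]
  strategy : Strategy d n E
  pool : Fin d → ℕ → Ω → Fin n
  data : ℕ → Fin d → Ω → E
  measurable_pool : ∀ i r, Measurable (pool i r)
  uniform_pool : ∀ i r m, P (pool i r ⁻¹' {m}) = (n : ENNReal)⁻¹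
  iIndepFun_pool : iIndepFun (fun p : Fin d × ℕ => pool p.1 p.2) P
  measurable_data : ∀ t i, Measurable (data t i)
  indepFun_future : ∀ t (i : Fin d), i.val + 1 < d →
    IndepFun
      (fun ω => (past strategy (fun k r => pool k r ω) (fun s j => data s j ω) t i, data t i ω))
      (fun ω => future strategy (fun k r => pool k r ω) (fun s j => data s j ω) t i) P

attribute [instance] ThinningProcess.measurableSpaceΩ ThinningProcess.isProbabilityMeasure
  ThinningProcess.measurableSpaceE

/-- The (random) maximum load after `t` balls. -/
def ThinningProcess.MaxLoad {d n : ℕ} [NeZero d] (T : ThinningProcess.{u, v} d n)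
    (t : ℕ) (ω : T.Ω) : ℕ :=
  maxLoad T.strategy (fun k r => T.pool k r ω) (fun s j => T.data s j ω) t

/-- `ℓ = (d log n / log log n) ^ (1/d)`. -/
noncomputable def ell (d n : ℕ) : ℝ :=
  ((d : ℝ) * Real.log n / Real.log (Real.log n)) ^ (1 / (d : ℝ))

end Thinning

/-!
The threshold `ℓ` satisfies `ℓ ^ (ℓ ^ d) ≈ n`.  Suppose that `N` bins have load at least `L` at
some time, and cut the following balls into windows of about `n / ℓ` balls each.  In each
window, about `N / ℓ` of these bins are offered in the first round.  If most of these offers are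
accepted, then `N / ℓ` bins have load `L + 1` when the window ends.  If not, then about `N / ℓ` balls
of this window are offered a second bin, and the argument is repeated in this window for the offers
of the second round, cut into windows again, and so on.  The last round has no rejections.

Quantitatively, let `κ` be `ℓ` times a constant, and consider the offers in some round, when
`n κ ^ (-e)` bins have the present load, and a window has `n κ ^ (-E)` offers (both up to constants).
Each unit of load gained costs a factor `κ ^ (-E)` in the number of bins.  If `j` units are gained
before the rejections prevail, then the next round has the exponents `e + j E` and
`e + (j + 1) E + 1 ≤ (j + 2) E` in the place of `e` and `E` (as `e + 1 ≤ E`).  So if the gains in the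
rounds are `j₁, j₂, …`, then all exponents stay below the product of the numbers `j_k + 2`.  If the
total gain is less than `(d - ε) ℓ`, then by the inequality of arithmetic and geometric means this
product is at most `((1 - ε / d) ℓ + 2) ^ d ≤ (1 - 2 ε / (3 d)) ℓ ^ d`, and all the numbers of bins
are at least `n ^ (2 ε / (3 d))`, since `κ ^ (ℓ ^ d) ≤ n`.  Hence the process cannot stop before the
load `(d - ε) ℓ` is reached.  This part, `Thinning.level_contradiction`, is deterministic.  It only
needs that the pools are typical (`Thinning.Typical`): for all times `a`, loads `L`, rounds
and numbers `N`, the next `N` entries of the pool after time `a` hit a fixed proportion of the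
expected number of bins of load at least `L`, if that number is not too small.

For fixed parameters, this condition fails with a probability exponentially small in the expected
number (`Thinning.card_few_hits_le_exp`), since the loads at time `a` are independent of the unused
pool entries (`Thinning.ThinningProcess.indepFun_load_future`), and these have the law of
the pools (`Thinning.ThinningProcess.map_future`).  The latter is proved round by round: whether
an offer is rejected is independent of the future, and the law of the pools is invariant
under shifts.  As `a` is not random, a union bound over polynomially many parameters suffices.
-/

namespace Thinning

section Dynamics

variable {d n : ℕ} [NeZero d] {E : Type v} [MeasurableSpace E]

/-! ### Counting offers -/

/-- Ball `t` is offered an allocation in round `i`, that is, all its earlier offers are rejected.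
The round is a natural number, so that `Reached f z x t d` makes sense (and never holds). -/
def Reached (f : Strategy d n E) (z : Fin d → ℕ → Fin n) (x : ℕ → Fin d → E) (t i : ℕ) : Prop :=
  ∀ k : Fin d, k.val < i →
    rejectsAt f z x t (run f z x t).1 (run f z x t).2 k = true

instance (f : Strategy d n E) (z : Fin d → ℕ → Fin n) (x : ℕ → Fin d → E) (t i : ℕ) :
    Decidable (Reached f z x t i) := by
  unfold Reached; infer_instance

/-- The number of offers made in round `i` to the first `t` balls; it extends `used` by zero to the
round `i = d`, so that a rejection in round `i` always counts as an offer in round `i + 1`. -/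
def offerCount (f : Strategy d n E) (z : Fin d → ℕ → Fin n) (x : ℕ → Fin d → E) (t i : ℕ) : ℕ :=
  ((Finset.range t).filter fun s => Reached f z x s i).card

/-- The bins whose load after `t` balls is at least `L`. -/
def loadedBins (f : Strategy d n E) (z : Fin d → ℕ → Fin n) (x : ℕ → Fin d → E) (t L : ℕ) :
    Finset (Fin n) :=
  Finset.univ.filter fun m => L ≤ load f z x t m

variable (f : Strategy d n E) (z : Fin d → ℕ → Fin n) (x : ℕ → Fin d → E)

lemma not_reached_last (t : ℕ) : ¬ Reached f z x t d := by
  intro h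
  obtain ⟨i, hi⟩ := exists_accepted f z x t (run f z x t).1 (run f z x t).2
  have := h i i.2
  simp_all

lemma offerCount_succ (t i : ℕ) :
    offerCount f z x (t + 1) i = offerCount f z x t i + if Reached f z x t i then 1 else 0 := by
  unfold offerCount
  rw [Finset.range_add_one, Finset.filter_insert]
  split_ifs with h
  · rw [Finset.card_insert_of_notMem (by simp)]
  · rfl

lemma offerCount_zero_left (i : ℕ) : offerCount f z x 0 i = 0 := by simp [offerCount]

lemma offerCount_first (t : ℕ) : offerCount f z x t 0 = t := by
  simp [offerCount, Reached]

lemma offerCount_last (t : ℕ) : offerCount f z x t d = 0 := by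
  simp [offerCount, not_reached_last]

lemma offerCount_mono (i : ℕ) : Monotone fun t => offerCount f z x t i := by
  refine monotone_nat_of_le_succ fun t => ?_
  rw [offerCount_succ]; exact Nat.le_add_right _ _

lemma used_succ (t : ℕ) (i : Fin d) :
    used f z x (t + 1) i = used f z x t i + if Reached f z x t i then 1 else 0 := rfl

lemma used_eq_offerCount (t : ℕ) (i : Fin d) : used f z x t i = offerCount f z x t i := by
  induction t with
  | zero => simp [offerCount_zero_left, used, run]
  | succ t ih => rw [used_succ, offerCount_succ, ih]

lemma alloc_eq_of_accepted {t : ℕ} {i : Fin d} (h : Reached f z x t i)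
    (h' : ¬ Reached f z x t (i + 1)) : alloc f z x t = z i (offerCount f z x t i) := by
  have hr : rejectsAt f z x t (run f z x t).1 (run f z x t).2 i = false := by
    by_contra hc
    apply h'
    intro k hk
    rcases Nat.lt_succ_iff_lt_or_eq.mp hk with hk | hk
    · exact h k hk
    · rw [Fin.ext hk]; simpa using hc
  have hj : chosenAt f z x t (run f z x t).1 (run f z x t).2 = i := by
    unfold chosenAt
    rw [Fin.find_eq_iff]
    exact ⟨hr, fun j hj => by simp [h j hj]⟩
  rw [← used_eq_offerCount]
  simp only [alloc, run, Fin.snoc_last, hj]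
  rfl

lemma load_succ (t : ℕ) (m : Fin n) :
    load f z x (t + 1) m = load f z x t m + if alloc f z x t = m then 1 else 0 := by
  unfold load
  rw [Finset.range_add_one, Finset.filter_insert]
  split_ifs with h
  · rw [Finset.card_insert_of_notMem (by simp)]
  · rfl

lemma load_mono (m : Fin n) : Monotone fun t => load f z x t m := by
  refine monotone_nat_of_le_succ fun t => ?_
  rw [load_succ]; exact Nat.le_add_right _ _

lemma mem_loadedBins {t L : ℕ} {m : Fin n} : m ∈ loadedBins f z x t L ↔ L ≤ load f z x t m := by
  simp [loadedBins]

/-- Among the distinct bins of load at least `L` that are offered in round `i` to the balls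
`a, …, t - 1`, all but one for each rejection in that round reach load `L + 1`. -/
lemma card_hit_le (i : Fin d) (a t L : ℕ) (hat : a ≤ t) :
    ((loadedBins f z x a L).filter fun m =>
        ∃ r < offerCount f z x t i, offerCount f z x a i ≤ r ∧ z i r = m).card +
      offerCount f z x a (i + 1) ≤
    (loadedBins f z x t (L + 1)).card + offerCount f z x t (i + 1) := by
  set S : ℕ → Finset (Fin n) := fun t => (loadedBins f z x a L).filter fun m =>
        ∃ r < offerCount f z x t i, offerCount f z x a i ≤ r ∧ z i r = m with hS
  have key : (S t \ loadedBins f z x t (L + 1)).card + offerCount f z x a (i + 1) ≤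
      offerCount f z x t (i + 1) := by
    induction t, hat using Nat.le_induction with
    | base =>
      have : S a = ∅ := by
        simp only [hS, Finset.filter_eq_empty_iff]
        rintro m - ⟨r, h2, h1, -⟩
        omega
      simp [this]
    | succ t hat ih =>
      have hB : loadedBins f z x t (L + 1) ⊆ loadedBins f z x (t + 1) (L + 1) := by
        intro m hm
        rw [mem_loadedBins] at hm ⊢
        exact hm.trans (load_mono f z x m (Nat.le_succ t))
      have hS' : S (t + 1) ⊆ insert (z i (offerCount f z x t i)) (S t) := by
        intro m hm
        simp only [hS, Finset.mem_filter, Finset.mem_insert] at hm ⊢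
        obtain ⟨hm, r, h2, h1, rfl⟩ := hm
        rw [offerCount_succ] at h2
        rcases Nat.lt_or_ge r (offerCount f z x t i) with h | h
        · exact Or.inr ⟨hm, r, h, h1, rfl⟩
        · have : r = offerCount f z x t i := by split_ifs at h2 <;> omega
          exact Or.inl (by rw [this])
      rw [offerCount_succ f z x t (i + 1)]
      by_cases h1 : Reached f z x t (i + 1)
      · rw [if_pos h1]
        have : S (t + 1) \ loadedBins f z x (t + 1) (L + 1) ⊆
            insert (z i (offerCount f z x t i)) (S t \ loadedBins f z x t (L + 1)) := by
          intro m hm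
          rw [Finset.mem_sdiff] at hm
          have h2 := hS' hm.1
          rw [Finset.mem_insert] at h2 ⊢
          rw [Finset.mem_sdiff]
          exact h2.imp id fun h => ⟨h, fun h' => hm.2 (hB h')⟩
        have := (Finset.card_le_card this).trans (Finset.card_insert_le _ _)
        omega
      · rw [if_neg h1]
        have : S (t + 1) \ loadedBins f z x (t + 1) (L + 1) ⊆
            S t \ loadedBins f z x t (L + 1) := by
          intro m hm
          rw [Finset.mem_sdiff] at hm ⊢
          refine ⟨?_, fun h' => hm.2 (hB h')⟩
          by_cases h0 : Reached f z x t i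
          · rcases Finset.mem_insert.mp (hS' hm.1) with h2 | h2
            · exfalso
              apply hm.2
              rw [mem_loadedBins, load_succ,
                if_pos ((alloc_eq_of_accepted f z x h0 h1).trans h2.symm)]
              have h3 : m ∈ loadedBins f z x a L := (Finset.mem_filter.mp hm.1).1
              rw [mem_loadedBins] at h3
              have := load_mono f z x m hat
              simp only at this
              omega
            · exact h2
          · have h3 : offerCount f z x (t + 1) i = offerCount f z x t i := by
              rw [offerCount_succ, if_neg h0, add_zero]
            have h4 := hm.1
            simp only [hS, h3] at h4
            exact h4
        have := Finset.card_le_card this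
        omega
  have h2 : (S t).card ≤ (S t \ loadedBins f z x t (L + 1)).card +
      (loadedBins f z x t (L + 1)).card := by
    have := Finset.le_card_sdiff (loadedBins f z x t (L + 1)) (S t)
    omega
  change (S t).card + _ ≤ _
  omega

lemma exists_offerCount_eq (i a T c : ℕ) (haT : a ≤ T) (h1 : offerCount f z x a i ≤ c)
    (h2 : c ≤ offerCount f z x T i) : ∃ t, a ≤ t ∧ t ≤ T ∧ offerCount f z x t i = c := by
  induction T, haT using Nat.le_induction with
  | base => exact ⟨a, le_rfl, le_rfl, le_antisymm h1 h2⟩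
  | succ T haT ih =>
    rcases Nat.lt_or_ge (offerCount f z x T i) c with h | h
    · refine ⟨T + 1, by omega, le_rfl, le_antisymm ?_ h2⟩
      rw [offerCount_succ]
      split_ifs <;> omega
    · obtain ⟨t, h3, h4, h5⟩ := ih h
      exact ⟨t, h3, by omega, h5⟩

/-! ### Gaining load, window by window -/

/-- The bins of load at least `L` after `a` balls that are hit by the next `N` entries of the pool
`i`, where the entry offered to ball `a` in its first round is skipped. -/
def hitBins (a L N : ℕ) (i : Fin d) : Finset (Fin n) :=
  (loadedBins f z x a L).filter fun m => ∃ r < N, future f z x a 0 i r = m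

/-- The pools are *typical* up to time `T`, with thresholds `q` for the expected number of hits
and `M` for the loads: whenever the next `N` entries of a pool are expected to hit the bins of
load at least `L` at least `q` times, at least an eighth of that number of these bins is hit. -/
def Typical (T M : ℕ) (q : ℝ) : Prop :=
  ∀ a ≤ T, ∀ L < M, ∀ N ≤ n, ∀ i : Fin d,
    q * n ≤ (loadedBins f z x a L).card * (N : ℝ) →
      (loadedBins f z x a L).card * (N : ℝ) / (8 * n) ≤ (hitBins f z x a L N i).card

lemma future_zero_apply (a : ℕ) (i : Fin d) :
    ∃ c, c ≤ 1 ∧ ∀ r, future f z x a 0 i r = z i (offerCount f z x a i + c + r) := by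
  by_cases h : i = 0
  · refine ⟨1, le_rfl, fun r => ?_⟩
    subst h
    simp [future, used_eq_offerCount, offerCount_first]
  · refine ⟨0, by omega, fun r => ?_⟩
    simp [future, used_eq_offerCount, h]

lemma card_hitBins_le (i : Fin d) (a t L N : ℕ) (hat : a ≤ t)
    (hN : offerCount f z x a i + (N + 1) ≤ offerCount f z x t i) :
    (hitBins f z x a L N i).card + offerCount f z x a (i + 1) ≤
    (loadedBins f z x t (L + 1)).card + offerCount f z x t (i + 1) := by
  refine le_trans (Nat.add_le_add_right (Finset.card_le_card ?_) _) (card_hit_le f z x i a t L hat)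
  intro m hm
  simp only [hitBins, Finset.mem_filter] at hm ⊢
  obtain ⟨hm, r, hr, rfl⟩ := hm
  obtain ⟨c, hc, h⟩ := future_zero_apply f z x a i
  exact ⟨hm, _, by omega, by omega, (h r).symm⟩

/-- In a window of `w` offers, `w ≈ 32 y`, in round `i`, at least `2 β y / n` bins are found that
either move up from load `L` to load `L + 1` or cause a rejection, if `β` bins have load at
least `L` when the window begins. -/
lemma window_gain {T M : ℕ} {q : ℝ} (hn : 0 < n) (htyp : Typical f z x T M q) {t t' L w : ℕ}
    (htT : t ≤ T) (htt' : t ≤ t') (hL : L < M) {β y : ℝ} (hβ : 0 ≤ β)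
    (hβB : β ≤ (loadedBins f z x t L).card) (hy : 1 ≤ y) (hw : 32 * y < w + 1) (hwn : w ≤ n)
    (hq : q * n ≤ 16 * (β * y)) (i : Fin d)
    (hcount : offerCount f z x t' i = offerCount f z x t i + w) :
    2 * (β * y / n) + offerCount f z x t (i + 1) ≤
      (loadedBins f z x t' (L + 1)).card + offerCount f z x t' (i + 1) := by
  have hn' : (0 : ℝ) < n := by exact_mod_cast hn
  have hwpos : 1 ≤ w := by
    have : (1 : ℝ) ≤ w := by linarith
    exact_mod_cast this
  obtain ⟨N, rfl⟩ : ∃ N, w = N + 1 := ⟨w - 1, by omega⟩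
  push_cast at hw
  -- one offer per window is lost in `hitBins`, and one by rounding
  have hN16 : 16 * y ≤ N := by linarith
  have hprod : 16 * (β * y) ≤ (loadedBins f z x t L).card * (N : ℝ) := by
    calc 16 * (β * y) = β * (16 * y) := by ring
      _ ≤ _ := mul_le_mul hβB hN16 (by linarith) (hβ.trans hβB)
  have hhit := htyp t htT L hL N (by omega) i (hq.trans hprod)
  have hhit' : 2 * (β * y / n) ≤ (hitBins f z x t L N i).card := by
    refine le_trans ?_ hhit
    rw [le_div_iff₀ (by positivity)]
    calc 2 * (β * y / n) * (8 * n) = 16 * (β * y) := by field_simp; ring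
      _ ≤ _ := hprod
  have h : ((hitBins f z x t L N i).card : ℝ) +
      offerCount f z x t (i + 1) ≤ (loadedBins f z x t' (L + 1)).card +
      offerCount f z x t' (i + 1) := by
    exact_mod_cast card_hitBins_le f z x i t t' L N htt' (by omega)
  linarith

/-- No strategy keeps all loads below `M`.  Suppose that at time `a` at least `n κ ^ (-e)` bins have
load at least `l.sum`, where `l` lists the gains in the earlier rounds, and that at least
`32 M n κ ^ (-E)` further offers in round `l.length` are made until time `T`.  Cut them into `M`
windows.  If few offers are rejected in a window, then the load of many of the bins grows
by one, at the price of a factor `κ ^ (-E)` for their number; if this happens in all windows, then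
some load reaches `M`.  Otherwise, the rejections in some window, the `(j+1)`-st say, are numerous;
they are offers in the next round, and the same applies to them, with `l` extended by `j`. -/
lemma level_contradiction {T M : ℕ} {q κ : ℝ} (hM : 0 < M) (hn : 0 < n) (hκ : 32 * M ≤ κ)
    (hκ' : 64 ≤ κ) (hq : 1 ≤ q) (hload : ∀ m, load f z x T m < M) (htyp : Typical f z x T M q)
    (hsize : ∀ l : List ℕ, l.length ≤ d → l.sum < M →
      q ≤ n * (κ ^ (l.map (· + 2)).prod)⁻¹) :
    ∀ k (l : List ℕ), l.length + k = d → ∀ a ≤ T, ∀ e E : ℕ, e + 1 ≤ E →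
      E ≤ (l.map (· + 2)).prod →
      n * (κ ^ e)⁻¹ ≤ (loadedBins f z x a l.sum).card →
      offerCount f z x a l.length + 32 * M * (n * (κ ^ E)⁻¹) ≤ offerCount f z x T l.length →
      False := by
  have hκ0 : 0 < κ := by linarith
  have hn' : (0 : ℝ) < n := by exact_mod_cast hn
  have hM' : (0 : ℝ) < M := by exact_mod_cast hM
  have hlt : ∀ a ≤ T, ∀ L, 0 < (loadedBins f z x a L).card → L < M := by
    intro a ha L h
    obtain ⟨m, hm⟩ := Finset.card_pos.mp h
    rw [mem_loadedBins] at hm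
    exact (hm.trans (load_mono f z x m ha)).trans_lt (hload m)
  intro k
  induction k with
  | zero =>
    intro l hl a ha e E _ _ _ h
    have : l.length = d := by omega
    rw [this, offerCount_last, offerCount_last] at h
    have : 0 < 32 * M * (n * (κ ^ E)⁻¹) := by positivity
    push_cast at h
    linarith
  | succ k ih =>
    intro l hl a ha e E heE hE hcard hoff
    obtain ⟨i, hi⟩ : ∃ i : Fin d, i.val = l.length := ⟨⟨l.length, by omega⟩, rfl⟩
    rw [← hi] at hoff
    -- `w` is the length of a window
    set w : ℕ := ⌊32 * (n * (κ ^ E)⁻¹)⌋₊ with hw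
    have hw_le : (w : ℝ) ≤ 32 * (n * (κ ^ E)⁻¹) := Nat.floor_le (by positivity)
    have hlt_w : 32 * (n * (κ ^ E)⁻¹) < w + 1 := Nat.lt_floor_add_one _
    have hMw : (M : ℝ) * w ≤ 32 * M * (n * (κ ^ E)⁻¹) := by nlinarith
    -- the number of bins can shrink further, by a factor of `κ ^ E`, without becoming too small
    have hstep : ∀ j, l.sum + j < M → q ≤ n * (κ ^ (e + j * E + E))⁻¹ := by
      intro j hj
      refine (hsize (l ++ [j]) (by simp; omega) (by simpa using hj)).trans ?_
      have : e + j * E + E ≤ ((l ++ [j]).map (· + 2)).prod := by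
        simp only [List.map_append, List.prod_append, List.map_cons, List.map_nil,
          List.prod_singleton]
        calc e + j * E + E ≤ E * (j + 2) := by nlinarith
          _ ≤ _ := Nat.mul_le_mul_right _ hE
      have h1 : κ ^ (e + j * E + E) ≤ κ ^ ((l ++ [j]).map (· + 2)).prod :=
        pow_le_pow_right₀ (by linarith) this
      gcongr
    have hwindows : ∀ j ≤ M, ∃ t ≤ T, offerCount f z x t i = offerCount f z x a i + j * w ∧
        n * (κ ^ (e + j * E))⁻¹ ≤ (loadedBins f z x t (l.sum + j)).card := by
      intro j
      induction j with
      | zero => intro _; exact ⟨a, ha, by simp, by simpa using hcard⟩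
      | succ j ihj =>
        intro hj
        obtain ⟨t, htT, htc, htb⟩ := ihj (by omega)
        have hb0 : (0 : ℝ) < (loadedBins f z x t (l.sum + j)).card :=
          lt_of_lt_of_le (by positivity) htb
        have hjM : l.sum + j < M := hlt t htT _ (by exact_mod_cast hb0)
        have hq' := hstep j hjM
        have hpow : κ ^ (e + j * E + E) = κ ^ (e + j * E) * κ ^ E := pow_add _ _ _
        have hone : 1 ≤ κ ^ (e + j * E) := one_le_pow₀ (by linarith)
        have hE1 : 1 ≤ n * (κ ^ E)⁻¹ := by
          refine (hq.trans hq').trans ?_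
          rw [hpow, mul_inv]
          have : (κ ^ (e + j * E))⁻¹ ≤ 1 := inv_le_one_of_one_le₀ hone
          have h0 : 0 ≤ (κ ^ E)⁻¹ := by positivity
          calc n * ((κ ^ (e + j * E))⁻¹ * (κ ^ E)⁻¹) ≤ n * (1 * (κ ^ E)⁻¹) := by gcongr
            _ = _ := by rw [one_mul]
        obtain ⟨t', htt', ht'T, ht'c⟩ := exists_offerCount_eq f z x i t T
          (offerCount f z x a i + (j + 1) * w) htT (by rw [htc]; nlinarith) (by
            have h1 : (((j + 1) * w : ℕ) : ℝ) ≤ M * w := by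
              exact_mod_cast Nat.mul_le_mul_right w hj
            have h2 : ((offerCount f z x a i + (j + 1) * w : ℕ) : ℝ) ≤ offerCount f z x T i := by
              rw [Nat.cast_add]; linarith
            exact_mod_cast h2)
        refine ⟨t', ht'T, ht'c, ?_⟩
        have hwn : w ≤ n := by
          have h1 : κ ≤ κ ^ E := by
            calc κ = κ ^ 1 := (pow_one κ).symm
              _ ≤ _ := pow_le_pow_right₀ (by linarith) (by omega)
          have h2 : (κ ^ E)⁻¹ ≤ 32⁻¹ := inv_anti₀ (by norm_num) (by linarith)
          have : (w : ℝ) ≤ n := by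
            calc (w : ℝ) ≤ 32 * (n * (κ ^ E)⁻¹) := hw_le
              _ ≤ 32 * (n * 32⁻¹) := by gcongr
              _ = n := by ring
          exact_mod_cast this
        have hβy : (n * (κ ^ (e + j * E))⁻¹) * (n * (κ ^ E)⁻¹) / n =
            n * (κ ^ (e + j * E + E))⁻¹ := by
          rw [hpow, mul_inv]; field_simp
        have hcount' := window_gain f z x hn htyp htT htt' hjM (by positivity) htb hE1 hlt_w hwn
          (by
            rw [div_eq_iff hn'.ne'] at hβy
            rw [hβy]
            have := mul_le_mul_of_nonneg_right hq' hn'.le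
            have h0 : 0 ≤ n * (κ ^ (e + j * E + E))⁻¹ * n := by positivity
            linarith) i (by rw [ht'c, htc]; ring)
        rw [hβy] at hcount'
        have hexp : e + (j + 1) * E = e + j * E + E := by ring
        rw [hexp, ← add_assoc]
        by_contra hsmall
        rw [not_le] at hsmall
        -- hence many offers in this window are rejected
        refine ih (l ++ [j]) (by simp; omega) t htT (e + j * E) (e + j * E + E + 1) (by omega)
          ?_ (by simpa using htb) ?_
        · simp only [List.map_append, List.prod_append, List.map_cons, List.map_nil,
            List.prod_singleton]
          calc e + j * E + E + 1 ≤ E * (j + 2) := by nlinarith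
            _ ≤ _ := Nat.mul_le_mul_right _ hE
        · have hlen : (l ++ [j]).length = i + 1 := by simp [hi]
          rw [hlen]
          have hmono : (offerCount f z x t' (i + 1) : ℝ) ≤ offerCount f z x T (i + 1) := by
            exact_mod_cast offerCount_mono f z x (i + 1) ht'T
          have hκM : 32 * M * (n * (κ ^ (e + j * E + E + 1))⁻¹) ≤
              n * (κ ^ (e + j * E + E))⁻¹ := by
            rw [pow_succ κ (e + j * E + E), mul_inv]
            have h0 : 0 < n * (κ ^ (e + j * E + E))⁻¹ := by positivity
            have h1 : 32 * M * κ⁻¹ ≤ 1 := by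
              rw [← div_eq_mul_inv]; exact (div_le_one hκ0).mpr hκ
            calc 32 * M * (n * ((κ ^ (e + j * E + E))⁻¹ * κ⁻¹))
                = (32 * M * κ⁻¹) * (n * (κ ^ (e + j * E + E))⁻¹) := by ring
              _ ≤ 1 * (n * (κ ^ (e + j * E + E))⁻¹) := by gcongr
              _ = _ := one_mul _
          linarith
    obtain ⟨t, htT, -, htb⟩ := hwindows M le_rfl
    have hb0 : (0 : ℝ) < (loadedBins f z x t (l.sum + M)).card :=
      lt_of_lt_of_le (by positivity) htb
    have := hlt t htT _ (by exact_mod_cast hb0)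
    omega

/-- If the pools are typical, then some load reaches `M`. -/
lemma le_maxLoad_of_typical {T M : ℕ} {q κ : ℝ} (hM : 0 < M) (hn : 0 < n) (hκ : 32 * M ≤ κ)
    (hκ' : 64 ≤ κ) (hq : 1 ≤ q) (hT : 32 * M * n ≤ T * κ) (htyp : Typical f z x T M q)
    (hsize : ∀ l : List ℕ, l.length ≤ d → l.sum < M →
      q ≤ n * (κ ^ (l.map (· + 2)).prod)⁻¹) : M ≤ maxLoad f z x T := by
  by_contra hlt
  rw [not_le] at hlt
  have hload : ∀ m, load f z x T m < M := fun m =>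
    (Finset.le_sup (Finset.mem_univ m)).trans_lt hlt
  refine level_contradiction f z x hM hn hκ hκ' hq hload htyp hsize d [] (by simp) 0 (Nat.zero_le _)
    0 1 le_rfl (by simp) ?_ ?_
  · simp [loadedBins]
  · simp only [List.length_nil, offerCount_first, Nat.cast_zero, zero_add, pow_one]
    rw [← mul_assoc, ← div_eq_mul_inv, div_le_iff₀ (by linarith)]
    exact hT

end Dynamics

end Thinning

namespace Thinning

/-! ### Uniform maps that hit few elements of a set -/

/-- The number of maps `Fin N → Fin n` that, together with `D`, cover fewer than `s` elements
of `B`.  As long as fewer than `s` elements of `B` are covered, a new value covers another one with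
probability at least `p = (#B - s) / n`, so `2 ^ (-#covered)` shrinks on average by
the factor `1 - p / 2`. -/
lemma card_few_hits_le {n : ℕ} (hn : 0 < n) (B : Finset (Fin n)) (s : ℕ) (hs : s ≤ B.card) (N : ℕ) :
    ∀ D : Finset (Fin n),
    (((Finset.univ : Finset (Fin N → Fin n)).filter fun v =>
        (B.filter fun m => m ∈ D ∨ ∃ r, v r = m).card < s).card : ℝ) * 2 ^ (B ∩ D).card ≤
      2 ^ s * (n * (1 - (B.card - s : ℝ) / (2 * n))) ^ N := by
  have hn' : (0 : ℝ) < n := by exact_mod_cast hn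
  have hBn : (B.card : ℝ) ≤ n := by
    exact_mod_cast (Finset.card_le_univ B).trans (by simp)
  have hs' : (s : ℝ) ≤ B.card := by exact_mod_cast hs
  set ρ : ℝ := n * (1 - (B.card - s : ℝ) / (2 * n)) with hρ
  have hρ' : ρ = n - (B.card - s : ℝ) / 2 := by rw [hρ]; field_simp
  have hρ0 : 0 ≤ ρ := by rw [hρ']; have : (0 : ℝ) ≤ s := by positivity
                         linarith
  have hfull : ∀ N : ℕ, ∀ D : Finset (Fin n), s ≤ (B ∩ D).card →
      ((Finset.univ : Finset (Fin N → Fin n)).filter fun v =>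
        (B.filter fun m => m ∈ D ∨ ∃ r, v r = m).card < s) = ∅ := by
    intro N D hD
    rw [Finset.filter_eq_empty_iff]
    intro v _
    rw [not_lt]
    refine hD.trans (Finset.card_le_card fun m hm => ?_)
    rw [Finset.mem_inter] at hm
    exact Finset.mem_filter.mpr ⟨hm.1, Or.inl hm.2⟩
  induction N with
  | zero =>
    intro D
    by_cases hD : s ≤ (B ∩ D).card
    · rw [hfull 0 D hD]; simp
    · simp only [pow_zero, mul_one]
      have h1 : (((Finset.univ : Finset (Fin 0 → Fin n)).filter fun v =>
        (B.filter fun m => m ∈ D ∨ ∃ r, v r = m).card < s).card : ℝ) ≤ 1 := by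
        exact_mod_cast (Finset.card_le_univ _).trans (by simp)
      calc _ ≤ 1 * (2 : ℝ) ^ (B ∩ D).card := by gcongr
        _ ≤ 2 ^ s := by rw [one_mul]; exact pow_le_pow_right₀ (by norm_num) (by omega)
  | succ N ih =>
    intro D
    by_cases hD : s ≤ (B ∩ D).card
    · rw [hfull _ D hD]; simp; positivity
    · rw [not_le] at hD
      -- split according to the first value
      have hsplit : (((Finset.univ : Finset (Fin (N + 1) → Fin n)).filter fun v =>
          (B.filter fun m => m ∈ D ∨ ∃ r, v r = m).card < s).card) =
          ∑ a : Fin n, ((Finset.univ : Finset (Fin N → Fin n)).filter fun v =>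
          (B.filter fun m => m ∈ insert a D ∨ ∃ r, v r = m).card < s).card := by
        simp only [Finset.card_filter]
        rw [← (Fin.consEquiv (fun _ => Fin n)).sum_comp, Fintype.sum_prod_type]
        refine Finset.sum_congr rfl fun a _ => Finset.sum_congr rfl fun v _ => ?_
        have : (B.filter fun m => m ∈ D ∨
              ∃ r, (Fin.consEquiv (fun _ : Fin (N + 1) => Fin n)) (a, v) r = m) =
            B.filter fun m => m ∈ insert a D ∨ ∃ r, v r = m := by
          refine Finset.filter_congr fun m _ => ?_
          simp only [Fin.consEquiv, Equiv.coe_fn_mk, Fin.exists_fin_succ, Fin.cons_zero,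
            Fin.cons_succ, Finset.mem_insert]
          tauto
        simp only [← Finset.card_filter, this]
      rw [hsplit, Nat.cast_sum, Finset.sum_mul]
      set X : ℝ := 2 ^ s * ρ ^ N with hX
      have hX0 : 0 ≤ X := by positivity
      have hterm : ∀ a : Fin n, (((Finset.univ : Finset (Fin N → Fin n)).filter fun v =>
          (B.filter fun m => m ∈ insert a D ∨ ∃ r, v r = m).card < s).card : ℝ) *
          2 ^ (B ∩ D).card ≤ X - if a ∈ B \ D then X / 2 else 0 := by
        intro a
        have h := ih (insert a D)
        split_ifs with ha
        · rw [Finset.mem_sdiff] at ha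
          have : (B ∩ insert a D).card = (B ∩ D).card + 1 := by
            rw [Finset.inter_insert_of_mem ha.1, Finset.card_insert_of_notMem]
            simp [ha.2]
          rw [this, pow_succ] at h
          linarith
        · have : B ∩ insert a D = B ∩ D := by
            ext m
            simp only [Finset.mem_inter, Finset.mem_insert, Finset.mem_sdiff, not_and,
              not_not] at ha ⊢
            constructor
            · rintro ⟨h1, rfl | h2⟩
              · exact ⟨h1, ha h1⟩
              · exact ⟨h1, h2⟩
            · exact fun h => ⟨h.1, Or.inr h.2⟩
          rw [this] at h
          linarith
      refine (Finset.sum_le_sum fun a _ => hterm a).trans ?_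
      rw [Finset.sum_sub_distrib, ← Finset.sum_filter, Finset.sum_const, Finset.sum_const]
      simp only [Finset.filter_mem_eq_inter, Finset.univ_inter, Finset.card_univ, Fintype.card_fin,
        nsmul_eq_mul]
      have hcard : (B.card : ℝ) - s ≤ (B \ D).card := by
        have h1 := Finset.card_sdiff_add_card_inter B D
        have h2 : ((B \ D).card : ℝ) + (B ∩ D).card = B.card := by exact_mod_cast h1
        have h3 : ((B ∩ D).card : ℝ) < s := by exact_mod_cast hD
        linarith
      rw [pow_succ]
      calc (n : ℝ) * X - (B \ D).card * (X / 2) ≤ n * X - (B.card - s) * (X / 2) := by gcongr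
        _ = 2 ^ s * (ρ ^ N * ρ) := by rw [hX, hρ']; ring

/-- If `N` independent uniform elements of `Fin n` are expected to hit `B` a number of times
`x = #B * N / n ≥ 8`, then they hit fewer than `x / 8` elements of `B` with probability at most
`exp (-x / 8)`. -/
lemma card_few_hits_le_exp {n : ℕ} (hn : 0 < n) (B : Finset (Fin n)) (N : ℕ) (hN : N ≤ n)
    (hx : 8 ≤ (B.card : ℝ) * N / n) :
    (((Finset.univ : Finset (Fin N → Fin n)).filter fun v =>
        ((B.filter fun m => ∃ r, v r = m).card : ℝ) < B.card * N / (8 * n)).card : ℝ) ≤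
      n ^ N * Real.exp (-((B.card : ℝ) * N / n / 8)) := by
  have hn' : (0 : ℝ) < n := by exact_mod_cast hn
  set b : ℝ := (B.card : ℝ) with hb
  have hb0 : 0 ≤ b := by positivity
  set X : ℝ := b * N / n with hX
  have hXb : X ≤ b := by
    rw [hX, div_le_iff₀ hn']
    have : (N : ℝ) ≤ n := by exact_mod_cast hN
    gcongr
  set s : ℕ := ⌈X / 8⌉₊ with hs
  have hs1 : (s : ℝ) < X / 8 + 1 := Nat.ceil_lt_add_one (by linarith)
  have hs2 : X / 8 ≤ s := Nat.le_ceil _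
  have hsB : s ≤ B.card := by
    have : (s : ℝ) ≤ B.card := by rw [← hb]; linarith
    exact_mod_cast this
  have h := card_few_hits_le hn B s hsB N ∅
  simp only [Finset.notMem_empty, false_or, Finset.inter_empty, Finset.card_empty, pow_zero,
    mul_one] at h
  have heq : b * N / (8 * n) = X / 8 := by rw [hX]; field_simp
  rw [heq]
  have h1 : (((Finset.univ : Finset (Fin N → Fin n)).filter fun v =>
        ((B.filter fun m => ∃ r, v r = m).card : ℝ) < X / 8).card : ℝ) ≤
      ((Finset.univ : Finset (Fin N → Fin n)).filter fun v =>
        (B.filter fun m => ∃ r, v r = m).card < s).card := by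
    have : ((Finset.univ : Finset (Fin N → Fin n)).filter fun v =>
        ((B.filter fun m => ∃ r, v r = m).card : ℝ) < X / 8) ⊆
      ((Finset.univ : Finset (Fin N → Fin n)).filter fun v =>
        (B.filter fun m => ∃ r, v r = m).card < s) := by
      intro v hv
      simp only [Finset.mem_filter, Finset.mem_univ, true_and] at hv ⊢
      exact_mod_cast hv.trans_le hs2
    exact_mod_cast Finset.card_le_card this
  refine (h1.trans h).trans ?_
  rw [← hb, mul_pow, mul_left_comm]
  refine mul_le_mul_of_nonneg_left ?_ (by positivity)
  have hp : 1 - (b - s) / (2 * n) ≤ Real.exp (-((b - s) / (2 * n))) := by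
    have := Real.add_one_le_exp (-((b - s) / (2 * n))); linarith
  have hp0 : 0 ≤ 1 - (b - s) / (2 * n) := by
    have hbn : b ≤ n := by
      rw [hb]; exact_mod_cast (Finset.card_le_univ B).trans (by simp)
    rw [sub_nonneg, div_le_one (by positivity)]
    have : (0 : ℝ) ≤ s := by positivity
    linarith
  have h2 : (2 : ℝ) ^ s ≤ Real.exp (0.7 * s) := by
    have : (2 : ℝ) ≤ Real.exp 0.7 := by
      rw [← Real.log_le_iff_le_exp (by norm_num)]
      have := Real.log_two_lt_d9; linarith
    calc (2 : ℝ) ^ s ≤ (Real.exp 0.7) ^ s := by gcongr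
      _ = Real.exp (0.7 * s) := by rw [← Real.exp_nat_mul]; ring_nf
  calc (2 : ℝ) ^ s * (1 - (b - s) / (2 * n)) ^ N
      ≤ Real.exp (0.7 * s) * Real.exp (-((b - s) / (2 * n))) ^ N := by gcongr
    _ = Real.exp (0.7 * s - (b - s) * N / (2 * n)) := by
        rw [← Real.exp_nat_mul, ← Real.exp_add]; congr 1; field_simp; ring
    _ ≤ _ := by
        apply Real.exp_le_exp.mpr
        have h3 : (3 / 4 * b) * N / (2 * n) ≤ (b - s) * N / (2 * n) := by
          gcongr
          linarith
        have h4 : (3 / 4 * b) * N / (2 * n) = 3 / 8 * X := by rw [hX]; field_simp; ring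
        linarith

end Thinning

namespace Thinning

section Dynamics

variable {d n : ℕ} [NeZero d] {E : Type v} [MeasurableSpace E]
variable (f : Strategy d n E) (z z' : Fin d → ℕ → Fin n) (x x' : ℕ → Fin d → E)

/-! ### Past and future of a run -/

lemma exists_accepting_round (t : ℕ) :
    ∃ i : Fin d, Reached f z x t i ∧ ¬ Reached f z x t (i + 1) := by
  by_contra! h
  have : ∀ i, i ≤ d → Reached f z x t i := by
    intro i
    induction i with
    | zero => intro _ k hk; omega
    | succ i ih => intro hi; exact h ⟨i, hi⟩ (ih (by omega))
  exact not_reached_last f z x t (this d le_rfl)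

lemma reached_anti {t i j : ℕ} (hij : i ≤ j) (h : Reached f z x t j) : Reached f z x t i :=
  fun k hk => h k (by omega)

lemma offer_eq (t : ℕ) (i : Fin d) : offer f z x t i =
    if Reached f z x t i then some (z i (offerCount f z x t i)) else none := by
  rw [← used_eq_offerCount]; rfl

lemma accepted_iff_offer (t : ℕ) (i : Fin d) :
    (Reached f z x t i ∧ ¬ Reached f z x t (i + 1)) ↔
      offer f z x t i ≠ none ∧ ∀ j, i < j → offer f z x t j = none := by
  simp only [offer_eq]
  constructor
  · rintro ⟨h1, h2⟩
    refine ⟨by simp [h1], fun j hj => ?_⟩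
    rw [if_neg]
    exact fun h => h2 (reached_anti f z x hj h)
  · rintro ⟨h1, h2⟩
    refine ⟨by by_contra h; simp [h] at h1, fun h => ?_⟩
    by_cases hd : i.val + 1 < d
    · simpa [h] using h2 ⟨i + 1, hd⟩ (by simp [Fin.lt_def])
    · have : i.val + 1 = d := by omega
      rw [this] at h
      exact not_reached_last f z x t h

/-- The final allocation of a ball is determined by its offers: it is the last of them. -/
lemma alloc_congr {t : ℕ} (h : ∀ i, offer f z x t i = offer f z' x' t i) :
    alloc f z x t = alloc f z' x' t := by
  obtain ⟨i, hi⟩ := exists_accepting_round f z x t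
  have hi' : Reached f z' x' t i ∧ ¬ Reached f z' x' t (i + 1) := by
    rw [accepted_iff_offer] at hi ⊢
    simpa only [h] using hi
  have := h i
  rw [offer_eq, offer_eq, if_pos hi.1, if_pos hi'.1, ← alloc_eq_of_accepted f z x hi.1 hi.2,
    ← alloc_eq_of_accepted f z' x' hi'.1 hi'.2] at this
  simpa using this

lemma load_congr {t : ℕ} (h : ∀ s < t, ∀ i, offer f z x s i = offer f z' x' s i) :
    load f z x t = load f z' x' t := by
  funext m
  unfold load
  congr 1
  refine Finset.filter_congr fun s hs => ?_
  rw [alloc_congr f z z' x x' (h s (Finset.mem_range.mp hs))]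

lemma run_snd_apply (t : ℕ) (s : Fin t) : (run f z x t).2 s = alloc f z x s := by
  induction t with
  | zero => exact s.elim0
  | succ t ih =>
    induction s using Fin.lastCases with
    | last => rfl
    | cast s => rw [Fin.val_castSucc, ← ih s]; simp [run]

lemma past_lt {t s : ℕ} (hs : s < t) (i j : Fin d) :
    past f z x t i s j = offer f z x s j := by simp [past, hs]

lemma past_self (t : ℕ) (i : Fin d) : past f z x t i t i = offer f z x t i := by simp [past]

lemma reached_succ_iff (t : ℕ) (i : Fin d) : Reached f z x t (i + 1) ↔
    Reached f z x t i ∧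
      f.rejects t i (run f z x t).2 (z i (offerCount f z x t i)) (x t i) = true := by
  rw [← used_eq_offerCount]
  constructor
  · exact fun h => ⟨reached_anti f z x (Nat.le_succ _) h, h i (Nat.lt_succ_self _)⟩
  · rintro ⟨h1, h2⟩ k hk
    rcases Nat.lt_succ_iff_lt_or_eq.mp hk with hk | hk
    · exact h1 k hk
    · rw [Fin.ext hk]; exact h2

lemma future_zero_zero : future f z x 0 0 = fun k r => z k ((if k = 0 then 1 else 0) + r) := by
  funext k r
  have h0 : ∀ k, used f z x 0 k = 0 := fun _ => rfl
  by_cases hk : k = 0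
  · subst hk
    simp [future, used_succ, h0, Reached]
  · simp [future, h0, hk]

lemma future_succ_zero (t : ℕ) (i : Fin d) (hi : i.val + 1 = d) : future f z x (t + 1) 0 =
    fun k r => future f z x t i k ((if k = 0 then 1 else 0) + r) := by
  funext k r
  have hk' : k ≤ i := by rw [Fin.le_def]; omega
  by_cases hk : k = 0
  · subst hk
    simp [future, used_succ f z x (t + 1), Reached, add_assoc]
  · simp [future, hk, hk']

lemma future_next (t : ℕ) (i j : Fin d) (hij : i.val + 1 = j.val) : future f z x t j =
    fun k r => future f z x t i k ((if k = j ∧ Reached f z x t j then 1 else 0) + r) := by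
  funext k r
  rcases lt_trichotomy k j with hk | hk | hk
  · have : k ≤ i := by rw [Fin.le_def]; rw [Fin.lt_def] at hk; omega
    simp [future, hk.le, hk.ne, this]
  · subst hk
    have : ¬ k ≤ i := by rw [Fin.le_def]; omega
    simp [future, this, used_succ, add_assoc]
  · have : ¬ k ≤ i := by rw [Fin.le_def]; rw [Fin.lt_def] at hk; omega
    simp [future, hk.ne', this, hk.not_ge]

end Dynamics

namespace ThinningProcess

variable {d n : ℕ} [NeZero d] (T : ThinningProcess.{u, v} d n)

/-! ### Measurability and the law of the future -/

/-- The realised pools. -/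
def Z (ω : T.Ω) : Fin d → ℕ → Fin n := fun k r => T.pool k r ω

/-- The realised external data. -/
def X (ω : T.Ω) : ℕ → Fin d → T.E := fun s j => T.data s j ω

lemma measurable_Z : Measurable T.Z :=
  measurable_pi_iff.mpr fun k => measurable_pi_iff.mpr fun r => T.measurable_pool k r

lemma measurable_apply_countable {Ω α β : Type*} [MeasurableSpace Ω] [MeasurableSpace α]
    [MeasurableSpace β] [Countable α] [MeasurableSingletonClass α] {g : Ω → α} {F : α → Ω → β}
    (hg : Measurable g) (hF : ∀ a, Measurable (F a)) : Measurable fun ω => F (g ω) ω := by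
  have : Measurable fun p : Ω × α => F p.2 p.1 := measurable_from_prod_countable_left hF
  exact this.comp (measurable_id.prodMk hg)

lemma measurable_rejectsAt {t : ℕ}
    (h : Measurable fun ω => run T.strategy (T.Z ω) (T.X ω) t) (i : Fin d) :
    Measurable fun ω => rejectsAt T.strategy (T.Z ω) (T.X ω) t
      (run T.strategy (T.Z ω) (T.X ω) t).1 (run T.strategy (T.Z ω) (T.X ω) t).2 i := by
  refine measurable_apply_countable h
    (F := fun p ω => rejectsAt T.strategy (T.Z ω) (T.X ω) t p.1 p.2 i) fun p => ?_
  exact measurable_apply_countable (T.measurable_pool i (p.1 i))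
    (F := fun b ω => T.strategy.rejects t i p.2 b (T.data t i ω)) fun b =>
      (T.strategy.measurable_rejects t i p.2 b).comp (T.measurable_data t i)

lemma measurable_run (t : ℕ) : Measurable fun ω => run T.strategy (T.Z ω) (T.X ω) t := by
  induction t with
  | zero => exact measurable_const
  | succ t ih =>
    have hrej : Measurable fun ω => fun i => rejectsAt T.strategy (T.Z ω) (T.X ω) t
        (run T.strategy (T.Z ω) (T.X ω) t).1 (run T.strategy (T.Z ω) (T.X ω) t).2 i :=
      measurable_pi_iff.mpr (T.measurable_rejectsAt ih)
    have hch : Measurable fun ω => chosenAt T.strategy (T.Z ω) (T.X ω) t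
        (run T.strategy (T.Z ω) (T.X ω) t).1 (run T.strategy (T.Z ω) (T.X ω) t).2 := by
      refine measurable_to_countable' fun j => ?_
      have : (fun ω => chosenAt T.strategy (T.Z ω) (T.X ω) t
          (run T.strategy (T.Z ω) (T.X ω) t).1 (run T.strategy (T.Z ω) (T.X ω) t).2) ⁻¹' {j} =
          (fun ω => fun i => rejectsAt T.strategy (T.Z ω) (T.X ω) t
        (run T.strategy (T.Z ω) (T.X ω) t).1 (run T.strategy (T.Z ω) (T.X ω) t).2 i) ⁻¹'
          {r | r j = false ∧ ∀ k < j, ¬ r k = false} := by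
        ext ω
        simp only [Set.mem_preimage, Set.mem_singleton_iff, Set.mem_ofPred_eq, chosenAt]
        rw [Fin.find_eq_iff]
      rw [this]
      exact hrej (MeasurableSet.of_discrete)
    have hpool : Measurable fun ω => T.Z ω (chosenAt T.strategy (T.Z ω) (T.X ω) t
          (run T.strategy (T.Z ω) (T.X ω) t).1 (run T.strategy (T.Z ω) (T.X ω) t).2)
          ((run T.strategy (T.Z ω) (T.X ω) t).1 (chosenAt T.strategy (T.Z ω) (T.X ω) t
          (run T.strategy (T.Z ω) (T.X ω) t).1 (run T.strategy (T.Z ω) (T.X ω) t).2)) :=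
      measurable_apply_countable (hch.prodMk ih)
        (F := fun (p : Fin d × (Fin d → ℕ) × (Fin t → Fin n)) ω => T.Z ω p.1 (p.2.1 p.1))
        fun p => T.measurable_pool p.1 (p.2.1 p.1)
    refine (measurable_of_countable (fun p : ((Fin d → ℕ) × (Fin t → Fin n)) × (Fin d → Bool) ×
        Fin n => ((fun i => p.1.1 i + if ∀ k < i, p.2.1 k = true then 1 else 0,
          Fin.snoc (α := fun _ => Fin n) p.1.2 p.2.2) : (Fin d → ℕ) × (Fin (t + 1) → Fin n)))).comp
      (ih.prodMk (hrej.prodMk hpool))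

lemma measurableSet_reached (t i : ℕ) :
    MeasurableSet {ω | Reached T.strategy (T.Z ω) (T.X ω) t i} := by
  have : {ω | Reached T.strategy (T.Z ω) (T.X ω) t i} = ⋂ k : Fin d, {ω | k.val < i →
      rejectsAt T.strategy (T.Z ω) (T.X ω) t
      (run T.strategy (T.Z ω) (T.X ω) t).1 (run T.strategy (T.Z ω) (T.X ω) t).2 k = true} := by
    ext ω; simp [Reached]
  rw [this]
  refine MeasurableSet.iInter fun k => ?_
  by_cases hk : k.val < i
  · simp only [hk, true_imp_iff]
    exact T.measurable_rejectsAt (T.measurable_run t) k (measurableSet_singleton true)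
  · simp [hk]

lemma measurable_future (t : ℕ) (i : Fin d) :
    Measurable fun ω => future T.strategy (T.Z ω) (T.X ω) t i := by
  refine measurable_pi_iff.mpr fun k => measurable_pi_iff.mpr fun r => ?_
  exact measurable_apply_countable ((T.measurable_run (t + 1)).prodMk (T.measurable_run t))
    (F := fun p ω => T.Z ω k ((if k ≤ i then p.1.1 k else p.2.1 k) + r))
    fun p => T.measurable_pool k ((if k ≤ i then p.1.1 k else p.2.1 k) + r)

lemma measurable_load (t : ℕ) :
    Measurable fun ω => load T.strategy (T.Z ω) (T.X ω) t := by
  have : (fun ω => load T.strategy (T.Z ω) (T.X ω) t) =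
      (fun h : Fin t → Fin n => fun m => (Finset.univ.filter fun s => h s = m).card) ∘
        fun ω => (run T.strategy (T.Z ω) (T.X ω) t).2 := by
    funext ω m
    simp only [load, Function.comp, run_snd_apply, Finset.card_filter]
    exact (Fin.sum_univ_eq_sum_range (fun s => if alloc T.strategy (T.Z ω) (T.X ω) s = m
      then 1 else 0) t).symm
  rw [this]
  exact (measurable_of_countable _).comp (measurable_snd.comp (T.measurable_run t))

/-- The law of the pools is invariant under deterministic shifts. -/
lemma map_shift (s : Fin d → ℕ) :
    (T.P.map T.Z).map (fun z k r => z k (s k + r)) = T.P.map T.Z := by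
  have hmarg : ∀ p p' : Fin d × ℕ, T.P.map (T.pool p.1 p.2) = T.P.map (T.pool p'.1 p'.2) := by
    intro p p'
    refine Measure.ext_of_singleton fun m => ?_
    rw [Measure.map_apply (T.measurable_pool _ _) (measurableSet_singleton _),
      Measure.map_apply (T.measurable_pool _ _) (measurableSet_singleton _),
      T.uniform_pool, T.uniform_pool]
  have hshift : Measurable fun (z : Fin d → ℕ → Fin n) (k : Fin d) (r : ℕ) => z k (s k + r) := by
    fun_prop
  have hcurry : Measurable fun (y : Fin d × ℕ → Fin n) (k : Fin d) (r : ℕ) => y (k, r) := by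
    fun_prop
  have hinj : Function.Injective fun p : Fin d × ℕ => (p.1, s p.1 + p.2) := by
    rintro ⟨k, r⟩ ⟨k', r'⟩ h
    simp only [Prod.mk.injEq] at h ⊢
    obtain ⟨rfl, h⟩ := h
    exact ⟨rfl, by omega⟩
  have h1 := (iIndepFun_iff_map_fun_eq_infinitePi_map
    (fun p : Fin d × ℕ => T.measurable_pool p.1 p.2)).mp T.iIndepFun_pool
  have h2 := (iIndepFun_iff_map_fun_eq_infinitePi_map
    (fun p : Fin d × ℕ => T.measurable_pool p.1 (s p.1 + p.2))).mp
      (T.iIndepFun_pool.precomp hinj)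
  have h3 : T.P.map (fun ω (p : Fin d × ℕ) => T.pool p.1 (s p.1 + p.2) ω) =
      T.P.map (fun ω (p : Fin d × ℕ) => T.pool p.1 p.2 ω) := by
    rw [h1, h2]
    congr 1
    funext p
    exact hmarg (p.1, s p.1 + p.2) p
  have h4 := congrArg (Measure.map fun (y : Fin d × ℕ → Fin n) (k : Fin d) (r : ℕ) => y (k, r)) h3
  rw [Measure.map_map hcurry (measurable_pi_iff.mpr fun p => T.measurable_pool _ _),
    Measure.map_map hcurry (measurable_pi_iff.mpr fun p => T.measurable_pool _ _)] at h4
  rw [Measure.map_map hshift T.measurable_Z]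
  exact h4

/-- Whether the offer in round `i` of ball `t` is made and rejected is independent of the future,
since it is a function of the past and of the data used for the decision. -/
lemma indepFun_reached_future (t : ℕ) (i : Fin d) (hi : i.val + 1 < d) :
    IndepFun (fun ω => decide (Reached T.strategy (T.Z ω) (T.X ω) t (i + 1)))
      (fun ω => future T.strategy (T.Z ω) (T.X ω) t i) T.P := by
  let R : (ℕ → Fin d → Option (Fin n)) → (Fin (t + 1) → Fin d → Option (Fin n)) :=
    fun p s => p s
  have hR : Measurable R := by fun_prop
  let g : T.Ω → Option ((Fin t → Fin n) × Fin n) := fun ω =>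
    if Reached T.strategy (T.Z ω) (T.X ω) t i then some ((run T.strategy (T.Z ω) (T.X ω) t).2,
      T.Z ω i (offerCount T.strategy (T.Z ω) (T.X ω) t i)) else none
  have hfac : Function.FactorsThrough g
      (fun ω => R (past T.strategy (T.Z ω) (T.X ω) t i)) := by
    intro ω ω' h
    have hs : ∀ s < t, ∀ j, offer T.strategy (T.Z ω) (T.X ω) s j =
        offer T.strategy (T.Z ω') (T.X ω') s j := by
      intro s hs j
      have := congrFun (congrFun h ⟨s, by omega⟩) j
      simpa only [R, past_lt _ _ _ hs] using this
    have ht : offer T.strategy (T.Z ω) (T.X ω) t i = offer T.strategy (T.Z ω') (T.X ω') t i := by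
      have := congrFun (congrFun h ⟨t, by omega⟩) i
      simpa only [R, past_self] using this
    have hrun : (run T.strategy (T.Z ω) (T.X ω) t).2 = (run T.strategy (T.Z ω') (T.X ω') t).2 := by
      funext s
      rw [run_snd_apply, run_snd_apply]
      exact alloc_congr _ _ _ _ _ (hs s s.2)
    simp only [offer_eq] at ht
    simp only [g, hrun]
    split_ifs at ht ⊢ with h1 h2
    · simpa using ht
    · rfl
  obtain ⟨e, he⟩ := (Function.factorsThrough_iff g).mp hfac
  have hφ : Measurable fun p : (ℕ → Fin d → Option (Fin n)) × T.E =>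
      ((e (R p.1)).elim false fun hb => T.strategy.rejects t i hb.1 hb.2 p.2) := by
    have : Measurable fun p : (Fin (t + 1) → Fin d → Option (Fin n)) × T.E =>
        ((e p.1).elim false fun hb => T.strategy.rejects t i hb.1 hb.2 p.2) := by
      refine measurable_from_prod_countable_right fun o => ?_
      change Measurable fun y => (e o).elim false fun hb => T.strategy.rejects t i hb.1 hb.2 y
      rcases e o with _ | hb
      · exact measurable_const
      · exact T.strategy.measurable_rejects t i hb.1 hb.2
    exact this.comp ((hR.comp measurable_fst).prodMk measurable_snd)
  have := (T.indepFun_future t i hi).comp hφ measurable_id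
  convert this using 1
  swap
  · rfl
  funext ω
  have hg := congrFun he ω
  simp only [Function.comp] at hg ⊢
  change _ = (e (R (past T.strategy (T.Z ω) (T.X ω) t i))).elim false _
  rw [← hg]
  simp only [g, reached_succ_iff]
  split_ifs with h1
  · simp [h1, X]
  · simp [h1]

/-- A mixture of a law and of its image under a map that preserves it. -/
lemma map_ite_eq {Ω α : Type*} [MeasurableSpace Ω] [MeasurableSpace α] {P : Measure Ω}
    [IsProbabilityMeasure P] {b : Ω → Bool} {F : Ω → α} {σ : α → α} (hb : Measurable b)
    (hF : Measurable F) (hσ : Measurable σ) (hind : IndepFun b F P)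
    (hinv : (P.map F).map σ = P.map F) :
    P.map (fun ω => if b ω = true then σ (F ω) else F ω) = P.map F := by
  have hbt : MeasurableSet {ω | b ω = true} := hb (measurableSet_singleton true)
  have hmeas : Measurable fun ω => if b ω = true then σ (F ω) else F ω :=
    Measurable.ite hbt (hσ.comp hF) hF
  ext S hS
  rw [Measure.map_apply hmeas hS, Measure.map_apply hF hS,
    ← measure_inter_add_sdiff _ hbt]
  have hσS : P (F ⁻¹' (σ ⁻¹' S)) = P (F ⁻¹' S) := by
    rw [← Measure.map_apply hF (hσ hS), ← Measure.map_apply hσ hS, hinv, Measure.map_apply hF hS]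
  have h1 : (fun ω => if b ω = true then σ (F ω) else F ω) ⁻¹' S ∩ {ω | b ω = true} =
      b ⁻¹' {true} ∩ F ⁻¹' (σ ⁻¹' S) := by
    ext ω
    simp only [Set.mem_inter_iff, Set.mem_preimage, Set.mem_ofPred_eq, Set.mem_singleton_iff]
    constructor
    · rintro ⟨h, h'⟩; simp only [h', if_true] at h; exact ⟨h', h⟩
    · rintro ⟨h', h⟩; simp only [h', if_true]; exact ⟨h, trivial⟩
  have h2 : (fun ω => if b ω = true then σ (F ω) else F ω) ⁻¹' S \ {ω | b ω = true} =
      b ⁻¹' {false} ∩ F ⁻¹' S := by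
    ext ω
    simp only [Set.mem_sdiff, Set.mem_inter_iff, Set.mem_preimage, Set.mem_ofPred_eq,
      Set.mem_singleton_iff, Bool.not_eq_true]
    constructor
    · rintro ⟨h, h'⟩; simp [h'] at h; exact ⟨h', h⟩
    · rintro ⟨h', h⟩; simp [h', h]
  rw [indepFun_iff_measure_inter_preimage_eq_mul] at hind
  rw [h1, h2, hind _ _ (measurableSet_singleton _) (hσ hS),
    hind _ _ (measurableSet_singleton _) hS, hσS, ← add_mul]
  have h3 : P (b ⁻¹' {true}) + P (b ⁻¹' {false}) = 1 := by
    rw [← measure_union _ (hb (measurableSet_singleton _)), ← Set.preimage_union]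
    · have : ({true} ∪ {false} : Set Bool) = Set.univ := by ext b; cases b <;> simp
      rw [this, Set.preimage_univ, measure_univ]
    · exact Disjoint.preimage _ (by simp)
  rw [h3, one_mul]

lemma map_future_next {t : ℕ} {i j : Fin d} (hij : i.val + 1 = j.val)
    (h : T.P.map (fun ω => future T.strategy (T.Z ω) (T.X ω) t i) = T.P.map T.Z) :
    T.P.map (fun ω => future T.strategy (T.Z ω) (T.X ω) t j) = T.P.map T.Z := by
  have hσ : Measurable fun (z : Fin d → ℕ → Fin n) (k : Fin d) (r : ℕ) =>
      z k ((if k = j then 1 else 0) + r) := by fun_prop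
  have hb : Measurable fun ω => decide (Reached T.strategy (T.Z ω) (T.X ω) t (i + 1)) :=
    measurable_to_bool (by simpa [Set.preimage] using T.measurableSet_reached t (i + 1))
  have := map_ite_eq hb (T.measurable_future t i) hσ
    (T.indepFun_reached_future t i (by omega)) (by rw [h]; exact T.map_shift _)
  rw [← h, ← this]
  congr 1
  funext ω
  rw [future_next _ _ _ t i j hij, hij]
  split_ifs with h1
  · simp only [decide_eq_true_eq] at h1; simp [h1]
  · simp only [decide_eq_true_eq] at h1; simp [h1]

/-- At every moment, the unused entries of the pools are distributed like the pools. -/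
lemma map_future (t : ℕ) (i : Fin d) :
    T.P.map (fun ω => future T.strategy (T.Z ω) (T.X ω) t i) = T.P.map T.Z := by
  have hd : 0 < d := Nat.pos_of_ne_zero (NeZero.ne d)
  have hσ : Measurable fun (z : Fin d → ℕ → Fin n) (k : Fin d) (r : ℕ) =>
      z k ((if k = 0 then 1 else 0) + r) := by fun_prop
  have hround : ∀ t, T.P.map (fun ω => future T.strategy (T.Z ω) (T.X ω) t 0) = T.P.map T.Z →
      ∀ (i : ℕ) (hi : i < d),
        T.P.map (fun ω => future T.strategy (T.Z ω) (T.X ω) t ⟨i, hi⟩) = T.P.map T.Z := by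
    intro t ht i
    induction i with
    | zero => exact fun _ => ht
    | succ i ih => exact fun hi => T.map_future_next (i := ⟨i, by omega⟩) rfl (ih (by omega))
  refine hround t ?_ i i.2
  induction t with
  | zero =>
    simp only [future_zero_zero]
    exact (Measure.map_map hσ T.measurable_Z).symm.trans (T.map_shift _)
  | succ t ih =>
    have h := hround t ih (d - 1) (by omega)
    simp only [future_succ_zero _ _ _ t ⟨d - 1, by omega⟩ (Nat.sub_add_cancel hd)]
    refine (Measure.map_map hσ (T.measurable_future t ⟨d - 1, by omega⟩)).symm.trans ?_
    rw [h]
    exact T.map_shift _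

/-- The loads after `t` balls are independent of the entries of each pool that are used after the
first round of ball `t`. -/
lemma indepFun_load_future (t N : ℕ) (i : Fin d) :
    IndepFun (fun ω => load T.strategy (T.Z ω) (T.X ω) t)
      (fun ω (r : Fin N) => future T.strategy (T.Z ω) (T.X ω) t 0 i r) T.P := by
  by_cases hd : 1 < d
  · let R : (ℕ → Fin d → Option (Fin n)) → (Fin t → Fin d → Option (Fin n)) := fun p s => p s
    have hR : Measurable R := by fun_prop
    have hfac : Function.FactorsThrough (fun ω => load T.strategy (T.Z ω) (T.X ω) t)
        (fun ω => R (past T.strategy (T.Z ω) (T.X ω) t 0)) := by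
      intro ω ω' h
      refine load_congr _ _ _ _ _ fun s hs j => ?_
      have := congrFun (congrFun h ⟨s, hs⟩) j
      simpa only [R, past_lt _ _ _ hs] using this
    obtain ⟨e, he⟩ := (Function.factorsThrough_iff _).mp hfac
    rw [he]
    have hψ : Measurable fun (y : Fin d → ℕ → Fin n) (r : Fin N) => y i r := by fun_prop
    exact (T.indepFun_future t 0 (by simpa using hd)).comp
      (((measurable_of_countable e).comp hR).comp measurable_fst) hψ
  -- for `d = 1` there are no decisions, and no hypothesis on the external data either
  · have hd1 : d = 1 := by have := NeZero.ne d; omega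
    have hlast : (0 : Fin d).val + 1 = d := by simp [hd1]
    have hi : i = 0 := Fin.ext (by have := i.2; simp; omega)
    have halloc : ∀ ω s, alloc T.strategy (T.Z ω) (T.X ω) s = T.pool 0 s ω := by
      intro ω s
      rw [alloc_eq_of_accepted T.strategy (T.Z ω) (T.X ω) (i := 0)
        (by intro k hk; simp at hk) (by rw [hlast]; exact not_reached_last _ _ _ s)]
      simp [offerCount_first, Z]
    have hfut : ∀ ω r, future T.strategy (T.Z ω) (T.X ω) t 0 i r = T.pool 0 (t + 1 + r) ω := by
      intro ω r
      subst hi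
      simp [future, used_eq_offerCount, offerCount_first, Z]
    have hind := T.iIndepFun_pool.indepFun_finset
      ((Finset.range t).image fun s => ((0 : Fin d), s))
      ((Finset.range N).image fun r => ((0 : Fin d), t + 1 + r))
      (by
        rw [Finset.disjoint_left]
        simp only [Finset.mem_image, Finset.mem_range, not_exists, not_and]
        rintro _ ⟨s, hs, rfl⟩ r hr h
        simp only [Prod.mk.injEq, true_and] at h
        omega)
      (fun p => T.measurable_pool p.1 p.2)
    let φ : (((Finset.range t).image fun s => ((0 : Fin d), s)) → Fin n) → Fin n → ℕ :=
      fun y m => (Finset.univ.filter fun s : Fin t =>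
        y ⟨(0, s), Finset.mem_image_of_mem _ (Finset.mem_range.mpr s.2)⟩ = m).card
    let ψ : (((Finset.range N).image fun r => ((0 : Fin d), t + 1 + r)) → Fin n) →
        Fin N → Fin n := fun y r =>
      y ⟨(0, t + 1 + r), Finset.mem_image_of_mem (fun r => ((0 : Fin d), t + 1 + r))
        (Finset.mem_range.mpr r.2)⟩
    convert hind.comp (φ := φ) (ψ := ψ) (measurable_of_countable _) (measurable_of_countable _)
      using 1
    · funext ω m
      simp only [load, Function.comp, φ, halloc, Finset.card_filter]
      exact (Fin.sum_univ_eq_sum_range (fun s => if T.pool 0 s ω = m then 1 else 0) t).symm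
    · funext ω r
      simp only [Function.comp, ψ, hfut]

/-- The next `N` entries of a pool are uniformly distributed on `Fin N → Fin n`. -/
lemma measure_future_mem (t N : ℕ) (i : Fin d) (S : Finset (Fin N → Fin n)) :
    T.P.map (fun ω (r : Fin N) => future T.strategy (T.Z ω) (T.X ω) t 0 i r) S =
      S.card * ((n : ENNReal)⁻¹) ^ N := by
  have hψ : Measurable fun (y : Fin d → ℕ → Fin n) (r : Fin N) => y i r := by fun_prop
  have h1 : T.P.map (fun ω (r : Fin N) => future T.strategy (T.Z ω) (T.X ω) t 0 i r) =
      T.P.map (fun ω (r : Fin N) => T.pool i r ω) := by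
    have := congrArg (Measure.map fun (y : Fin d → ℕ → Fin n) (r : Fin N) => y i r)
      (T.map_future t 0)
    rw [Measure.map_map hψ (T.measurable_future t 0), Measure.map_map hψ T.measurable_Z] at this
    exact this
  have h2 : T.P.map (fun ω (r : Fin N) => T.pool i r ω) =
      Measure.pi fun r : Fin N => T.P.map (T.pool i r) :=
    (iIndepFun_iff_map_fun_eq_pi_map (f := fun r : Fin N => T.pool i r)
      fun r => (T.measurable_pool i r).aemeasurable).mp
      (T.iIndepFun_pool.precomp (g := fun r : Fin N => (i, (r : ℕ)))
        (fun r r' h => Fin.ext (by simpa using h)))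
  have : ∀ r : Fin N, IsProbabilityMeasure (T.P.map (T.pool i r)) := fun r =>
    Measure.isProbabilityMeasure_map (T.measurable_pool i r).aemeasurable
  have hsum : ∀ μ : Measure (Fin N → Fin n), μ S = ∑ v ∈ S, μ {v} := fun μ =>
    (sum_measure_singleton (s := S) (μ := μ)).symm
  rw [h1, h2, hsum]
  have h3 : ∀ v : Fin N → Fin n, (Measure.pi fun r : Fin N => T.P.map (T.pool i r)) {v} =
      ((n : ENNReal)⁻¹) ^ N := by
    intro v
    rw [Measure.pi_singleton]
    simp [Measure.map_apply (T.measurable_pool i _) (measurableSet_singleton _), T.uniform_pool]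
  simp [h3]

/-! ### The pools are typical -/

/-- Each of the conditions in `Typical` fails with probability at most `exp (-q / 8)`. -/
lemma measureReal_few_hits_le (hn : 0 < n) (a L N : ℕ) (hN : N ≤ n) (i : Fin d) {q : ℝ}
    (hq : 8 ≤ q) :
    T.P.real {ω | q * n ≤ (loadedBins T.strategy (T.Z ω) (T.X ω) a L).card * (N : ℝ) ∧
      ((hitBins T.strategy (T.Z ω) (T.X ω) a L N i).card : ℝ) <
        (loadedBins T.strategy (T.Z ω) (T.X ω) a L).card * (N : ℝ) / (8 * n)} ≤
      Real.exp (-(q / 8)) := by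
  have hn' : (0 : ℝ) < n := by exact_mod_cast hn
  let B : (Fin n → ℕ) → Finset (Fin n) := fun y => Finset.univ.filter fun m => L ≤ y m
  let W : Set ((Fin n → ℕ) × (Fin N → Fin n)) := {p | q * n ≤ (B p.1).card * (N : ℝ) ∧
    (((B p.1).filter fun m => ∃ r, p.2 r = m).card : ℝ) < (B p.1).card * (N : ℝ) / (8 * n)}
  have hψ : Measurable fun (y : Fin d → ℕ → Fin n) (r : Fin N) => y i r := by fun_prop
  have hX := T.measurable_load a
  have hY : Measurable fun ω (r : Fin N) => future T.strategy (T.Z ω) (T.X ω) a 0 i r :=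
    hψ.comp (T.measurable_future a 0)
  have hW : MeasurableSet W := MeasurableSet.of_discrete
  have hset : {ω | q * n ≤ (loadedBins T.strategy (T.Z ω) (T.X ω) a L).card * (N : ℝ) ∧
      ((hitBins T.strategy (T.Z ω) (T.X ω) a L N i).card : ℝ) <
        (loadedBins T.strategy (T.Z ω) (T.X ω) a L).card * (N : ℝ) / (8 * n)} =
      (fun ω => (load T.strategy (T.Z ω) (T.X ω) a,
        fun r : Fin N => future T.strategy (T.Z ω) (T.X ω) a 0 i r)) ⁻¹' W := by
    ext ω
    have : hitBins T.strategy (T.Z ω) (T.X ω) a L N i =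
        (B (load T.strategy (T.Z ω) (T.X ω) a)).filter fun m =>
          ∃ r : Fin N, future T.strategy (T.Z ω) (T.X ω) a 0 i r = m := by
      refine Finset.filter_congr fun m _ => ?_
      exact ⟨fun ⟨r, hr, h⟩ => ⟨⟨r, hr⟩, h⟩, fun ⟨r, h⟩ => ⟨r, r.2, h⟩⟩
    simp only [Set.mem_ofPred_eq, this]
    rfl
  have hprob : IsProbabilityMeasure
      (T.P.map fun ω => load T.strategy (T.Z ω) (T.X ω) a) :=
    Measure.isProbabilityMeasure_map hX.aemeasurable
  have hprob' : IsProbabilityMeasure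
      (T.P.map fun ω (r : Fin N) => future T.strategy (T.Z ω) (T.X ω) a 0 i r) :=
    Measure.isProbabilityMeasure_map hY.aemeasurable
  have hmap := (indepFun_iff_map_prod_eq_prod_map_map hX.aemeasurable hY.aemeasurable).mp
    (T.indepFun_load_future a N i)
  rw [measureReal_def, hset, ← Measure.map_apply (hX.prodMk hY) hW, hmap, Measure.prod_apply hW]
  refine ENNReal.toReal_le_of_le_ofReal (Real.exp_nonneg _) ?_
  refine (lintegral_mono (g := fun _ => ENNReal.ofReal (Real.exp (-(q / 8)))) fun y => ?_).trans
    (by simp)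
  by_cases hy : q * n ≤ (B y).card * (N : ℝ)
  · have hx : q ≤ (B y).card * (N : ℝ) / n := (le_div_iff₀ hn').mpr hy
    have hsec : Prod.mk y ⁻¹' W = (((Finset.univ : Finset (Fin N → Fin n)).filter fun v =>
        (((B y).filter fun m => ∃ r, v r = m).card : ℝ) < (B y).card * (N : ℝ) / (8 * n) :
          Finset (Fin N → Fin n)) : Set (Fin N → Fin n)) := by
      ext v
      simp [W, hy]
    have hcard := card_few_hits_le_exp hn (B y) N hN (hq.trans hx)
    simp only
    rw [hsec, T.measure_future_mem, ← ENNReal.ofReal_natCast, ← ENNReal.ofReal_natCast n,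
      ← ENNReal.ofReal_inv_of_pos hn', ← ENNReal.ofReal_pow (by positivity),
      ← ENNReal.ofReal_mul (by positivity)]
    refine ENNReal.ofReal_le_ofReal ?_
    calc _ ≤ n ^ N * Real.exp (-((B y).card * (N : ℝ) / n / 8)) * (n : ℝ)⁻¹ ^ N := by gcongr
      _ = Real.exp (-((B y).card * (N : ℝ) / n / 8)) := by
        rw [mul_right_comm, ← mul_pow, mul_inv_cancel₀ hn'.ne', one_pow, one_mul]
      _ ≤ _ := by gcongr
  · have hsec : Prod.mk y ⁻¹' W = ∅ := by
      ext v
      simp only [W, Set.mem_preimage, Set.mem_ofPred_eq, Set.mem_empty_iff_false, iff_false,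
        not_and]
      exact fun h => absurd h hy
    simp [hsec]

/-- The pools are typical with high probability. -/
lemma measureReal_not_typical_le (hn : 0 < n) (t M : ℕ) {q : ℝ} (hq : 8 ≤ q) :
    T.P.real {ω | ¬ Typical T.strategy (T.Z ω) (T.X ω) t M q} ≤
      (t + 1) * M * (n + 1) * d * Real.exp (-(q / 8)) := by
  let I : Finset (ℕ × ℕ × ℕ × Fin d) :=
    Finset.range (t + 1) ×ˢ Finset.range M ×ˢ Finset.range (n + 1) ×ˢ Finset.univ
  let A : ℕ × ℕ × ℕ × Fin d → Set T.Ω := fun p =>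
    {ω | q * n ≤ (loadedBins T.strategy (T.Z ω) (T.X ω) p.1 p.2.1).card * (p.2.2.1 : ℝ) ∧
      ((hitBins T.strategy (T.Z ω) (T.X ω) p.1 p.2.1 p.2.2.1 p.2.2.2).card : ℝ) <
        (loadedBins T.strategy (T.Z ω) (T.X ω) p.1 p.2.1).card * (p.2.2.1 : ℝ) / (8 * n)}
  have hsub : {ω | ¬ Typical T.strategy (T.Z ω) (T.X ω) t M q} ⊆ ⋃ p ∈ I, A p := by
    intro ω hω
    simp only [Set.mem_ofPred_eq, Typical] at hω
    push Not at hω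
    obtain ⟨a, ha, L, hL, N, hN, i, h1, h2⟩ := hω
    refine Set.mem_biUnion (x := (a, L, N, i)) ?_ ⟨h1, h2⟩
    rw [Finset.mem_coe]
    simp only [I, Finset.mem_product, Finset.mem_range, Finset.mem_univ, and_true]
    omega
  calc _ ≤ T.P.real (⋃ p ∈ I, A p) := measureReal_mono hsub (measure_ne_top _ _)
    _ ≤ ∑ p ∈ I, T.P.real (A p) := measureReal_biUnion_finset_le _ _
    _ ≤ ∑ _p ∈ I, Real.exp (-(q / 8)) := by
      refine Finset.sum_le_sum fun p hp => ?_
      simp only [I, Finset.mem_product, Finset.mem_range] at hp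
      exact T.measureReal_few_hits_le hn p.1 p.2.1 p.2.2.1 (by omega) p.2.2.2 hq
    _ = _ := by
      simp only [I, Finset.sum_const, Finset.card_product, Finset.card_range, Finset.card_univ,
        Fintype.card_fin, nsmul_eq_mul]
      push_cast
      ring

end ThinningProcess
end Thinning

namespace Thinning

open Filter

/-! ### Asymptotics -/

/-- The inequality of arithmetic and geometric means, in a form suited to induction: it follows
from `y / A ≤ exp (y / A - 1)` for the factors `y = j + 2`. -/
lemma prod_add_two_le_exp (l : List ℕ) {A : ℝ} (hA : 0 < A) :
    (((l.map (· + 2)).prod : ℕ) : ℝ) ≤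
      A ^ l.length * Real.exp (((l.sum : ℝ) + 2 * l.length) / A - l.length) := by
  induction l with
  | nil => simp
  | cons j l ih =>
    have h : ((j + 2 : ℕ) : ℝ) ≤ A * Real.exp (((j : ℝ) + 2) / A - 1) := by
      have h1 := Real.add_one_le_exp (((j : ℝ) + 2) / A - 1)
      rw [sub_add_cancel, div_le_iff₀ hA] at h1
      push_cast
      linarith
    simp only [List.map_cons, List.prod_cons, List.length_cons, List.sum_cons]
    rw [Nat.cast_mul]
    calc ((j + 2 : ℕ) : ℝ) * ((l.map (· + 2)).prod : ℕ)
        ≤ (A * Real.exp (((j : ℝ) + 2) / A - 1)) *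
          (A ^ l.length * Real.exp (((l.sum : ℝ) + 2 * l.length) / A - l.length)) := by gcongr
      _ = A ^ (l.length + 1) * (Real.exp (((j : ℝ) + 2) / A - 1) *
          Real.exp (((l.sum : ℝ) + 2 * l.length) / A - l.length)) := by ring
      _ = _ := by
        rw [← Real.exp_add]
        push_cast
        congr 2
        ring

lemma prod_add_two_le_pow {d : ℕ} (l : List ℕ) (hl : l.length ≤ d) {A : ℝ} (hA : 0 < A)
    (hsum : (l.sum : ℝ) + 2 * d ≤ d * A) : (((l.map (· + 2)).prod : ℕ) : ℝ) ≤ A ^ d := by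
  -- pad the list with zeros
  have h := prod_add_two_le_exp (l ++ List.replicate (d - l.length) 0) hA
  have hlen : (l ++ List.replicate (d - l.length) 0).length = d := by simp; omega
  have hs : (l ++ List.replicate (d - l.length) 0).sum = l.sum := by simp
  have hp : (l.map (· + 2)).prod ≤
      ((l ++ List.replicate (d - l.length) 0).map (· + 2)).prod := by
    rw [List.map_append, List.prod_append]
    refine Nat.le_mul_of_pos_right _ ?_
    simp
  rw [hlen, hs] at h
  have hexp : Real.exp (((l.sum : ℝ) + 2 * d) / A - d) ≤ 1 := by
    rw [Real.exp_le_one_iff, sub_nonpos, div_le_iff₀ hA]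
    exact hsum
  calc (((l.map (· + 2)).prod : ℕ) : ℝ) ≤ _ := Nat.cast_le.mpr hp
    _ ≤ _ := h
    _ ≤ A ^ d * 1 := by gcongr
    _ = _ := mul_one _

/-- The conditions on `n` under which the lower bound is proved for all `ε ≥ 1 / log (log n)`.  The
factor of `ell d n` in `log_mul_pow_le` bounds the ratio of `κ` to `ell d n`; the condition holds for
large `n`, whatever that factor, because `log (ell d n) * ell d n ^ d` is smaller than `log n` by
about `log n * log (log (log n)) / log (log n)`. -/
structure IsLarge (d : ℕ) (ρ : ℝ) (n : ℕ) : Prop where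
  one_le_loglog : 1 ≤ Real.log (Real.log n)
  loglog_le_ell : 6 * d * Real.log (Real.log n) ≤ ell d n
  log_mul_pow_le : Real.log (64 * (1 + 1 / ρ) * (d + 1) * ell d n) * ell d n ^ d ≤ Real.log n
  log_le_exp : Real.log n ≤ Real.exp (Real.log n / (3 * d * Real.log (Real.log n)))
  le_log : 64 ≤ Real.log n
  lt_self : 2 * d * (ρ + 1) < n
  ell_le : (d + 1) * ell d n ≤ n
  two_le : 2 ≤ ρ * n

lemma ell_pow {d n : ℕ} (hd : d ≠ 0) (h : 0 ≤ (d : ℝ) * Real.log n / Real.log (Real.log n)) :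
    ell d n ^ d = (d : ℝ) * Real.log n / Real.log (Real.log n) := by
  rw [ell, one_div, Real.rpow_inv_natCast_pow h hd]

lemma eventually_isLarge (d : ℕ) (hd : d ≠ 0) {ρ : ℝ} (hρ : 0 < ρ) :
    ∀ᶠ n : ℕ in atTop, IsLarge d ρ n := by
  have hd1 : (1 : ℝ) ≤ d := by exact_mod_cast Nat.one_le_iff_ne_zero.mpr hd
  have hn : Tendsto (fun n : ℕ => (n : ℝ)) atTop atTop := tendsto_natCast_atTop_atTop
  have hL : Tendsto (fun n : ℕ => Real.log n) atTop atTop := Real.tendsto_log_atTop.comp hn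
  have hy : Tendsto (fun n : ℕ => Real.log (Real.log n)) atTop atTop :=
    Real.tendsto_log_atTop.comp hL
  have hexp : ∀ (c : ℝ) (k : ℕ), ∀ᶠ y : ℝ in atTop, c * y ^ k ≤ Real.exp y := by
    intro c k
    have h := (Real.isLittleO_pow_exp_atTop (n := k)).bound (c := (|c| + 1)⁻¹) (by positivity)
    filter_upwards [h, eventually_ge_atTop 0] with y hy hy0
    rw [Real.norm_of_nonneg (by positivity), Real.norm_of_nonneg (by positivity),
      inv_mul_eq_div, le_div_iff₀ (by positivity)] at hy
    have : c * y ^ k ≤ (|c| + 1) * y ^ k := by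
      have := le_abs_self c
      gcongr
      linarith
    linarith
  set C : ℝ := 64 * (1 + 1 / ρ) * (d + 1) with hC
  have hC0 : 0 < C := by positivity
  have e1 := hy.eventually (hexp ((6 * d) ^ d) (d + 1))
  have e2 := hy.eventually (hexp (3 * d) 2)
  have e3 := hL.eventually (hexp ((d + 1) * d) 1)
  have e4 := (Real.tendsto_log_atTop.comp hy).eventually_ge_atTop (d * Real.log C + Real.log d)
  filter_upwards [e1, e2, e3, e4, hy.eventually_ge_atTop 1, hL.eventually_ge_atTop 64,
    hn.eventually_gt_atTop (2 * d * (ρ + 1)), hn.eventually_ge_atTop (2 / ρ)]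
    with n e1 e2 e3 e4 hy1 hL64 hn1 hn2
  set L := Real.log n with hLdef
  set y := Real.log L with hydef
  have hL0 : 0 < L := by linarith
  have hy0 : 0 < y := by linarith
  have hLy : Real.exp y = L := Real.exp_log hL0
  have hn0 : (0 : ℝ) < n := lt_of_le_of_lt (by positivity) hn1
  have hnL : Real.exp L = n := Real.exp_log hn0
  have hpow : ell d n ^ d = d * L / y := ell_pow hd (by positivity)
  have hell0 : 0 < ell d n := by unfold ell; positivity
  rw [hLy] at e1 e2
  have hge : 6 * d * y ≤ ell d n := by
    refine le_of_pow_le_pow_left₀ hd hell0.le ?_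
    rw [hpow, le_div_iff₀ hy0]
    calc (6 * d * y) ^ d * y = (6 * d) ^ d * y ^ (d + 1) := by ring
      _ ≤ L := e1
      _ ≤ d * L := by nlinarith
  have hell1 : 1 ≤ ell d n := by nlinarith
  refine ⟨hy1, hge, ?_, ?_, hL64, hn1, ?_, ?_⟩
  · have hlog : d * Real.log (ell d n) = Real.log d + y - Real.log y := by
      rw [← Real.log_pow, hpow, Real.log_div (by positivity) hy0.ne',
        Real.log_mul (by positivity) hL0.ne']
    rw [hpow, Real.log_mul hC0.ne' hell0.ne', ← mul_div_assoc, div_le_iff₀ hy0]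
    simp only [Function.comp] at e4
    calc (Real.log C + Real.log (ell d n)) * (d * L)
        = L * (d * Real.log C + d * Real.log (ell d n)) := by ring
      _ ≤ L * y := by
        refine mul_le_mul_of_nonneg_left ?_ hL0.le
        linarith
  · rw [← Real.log_le_iff_le_exp hL0, le_div_iff₀ (by positivity)]
    linarith
  · have h1 : ell d n ≤ ell d n ^ d := le_self_pow₀ hell1 hd
    have h2 : d * L / y ≤ d * L := div_le_self (by positivity) hy1
    rw [pow_one, hnL] at e3
    calc (d + 1) * ell d n ≤ (d + 1) * (d * L) := by gcongr; linarith
      _ ≤ n := by linarith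
  · rw [div_le_iff₀ hρ] at hn2; linarith

/-- A set of the expected size is never smaller than `n ^ (2 ε / (3 d))`: since
`κ ^ (ℓ ^ d) ≤ n`, it suffices that the exponent of `κ`, which is at most
`((d - ε) ℓ / d + 2) ^ d` by the inequality of arithmetic and geometric means, is at most
`(1 - 2 ε / (3 d)) ℓ ^ d`. -/
lemma rpow_le_of_isLarge {d n : ℕ} (hd : d ≠ 0) {ρ ε κ : ℝ} (hlarge : IsLarge d ρ n)
    (hε : 1 / Real.log (Real.log n) ≤ ε) (hεd : ε < d) (hκ1 : 1 ≤ κ)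
    (hκ : κ ≤ 64 * (1 + 1 / ρ) * (d + 1) * ell d n) (l : List ℕ) (hl : l.length ≤ d)
    (hsum : (l.sum : ℝ) ≤ (d - ε) * ell d n) :
    (n : ℝ) ^ (2 * ε / (3 * d)) ≤ n * (κ ^ (l.map (· + 2)).prod)⁻¹ := by
  have hd0 : (0 : ℝ) < d := by exact_mod_cast Nat.pos_of_ne_zero hd
  have hd1 : (1 : ℝ) ≤ d := by exact_mod_cast Nat.one_le_iff_ne_zero.mpr hd
  have hy := hlarge.one_le_loglog
  have hell := hlarge.loglog_le_ell
  have hlog := hlarge.log_mul_pow_le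
  have hL := hlarge.le_log
  set y := Real.log (Real.log n) with hydef
  set ℓ := ell d n with hℓ
  have hy0 : 0 < y := by linarith
  have hℓ0 : 0 < ℓ := lt_of_lt_of_le (by positivity) hell
  have hn0 : (0 : ℝ) < n := by
    rcases Nat.eq_zero_or_pos n with h | h
    · rw [h] at hL; norm_num at hL
    · exact_mod_cast h
  -- the rounding error is negligible: `2 / ℓ ≤ ε / (3 d)`
  have h2 : 2 ≤ ε / (3 * d) * ℓ := by
    have h3 : 1 ≤ ε * y := by rwa [div_le_iff₀ hy0] at hε
    have hε0 : 0 < ε := lt_of_lt_of_le (by positivity) hε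
    calc (2 : ℝ) ≤ 2 * (ε * y) := by linarith
      _ = ε / (3 * d) * (6 * d * y) := by field_simp; ring
      _ ≤ _ := by gcongr
  set u : ℝ := 1 - 2 * ε / (3 * d) with hu
  have hu1 : u ≤ 1 := by
    have hε0 : 0 < ε := lt_of_lt_of_le (by positivity) hε
    have : 0 ≤ 2 * ε / (3 * d) := by positivity
    linarith
  have hu0 : 0 < u := by
    have : 2 * ε / (3 * d) < 1 := by rw [div_lt_one (by positivity)]; linarith
    linarith
  have hprod := prod_add_two_le_pow l hl (A := u * ℓ) (by positivity) (by
    have : d * (u * ℓ) = (d - ε) * ℓ + d * (ε / (3 * d) * ℓ) := by rw [hu]; field_simp; ring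
    rw [this]
    have := mul_le_mul_of_nonneg_left h2 hd0.le
    linarith)
  have hlogκ : 0 ≤ Real.log κ := Real.log_nonneg hκ1
  have hexp : ((l.map (· + 2)).prod : ℕ) * Real.log κ ≤ u * Real.log n := by
    calc ((l.map (· + 2)).prod : ℕ) * Real.log κ ≤ (u * ℓ) ^ d * Real.log κ := by gcongr
      _ = u ^ d * (Real.log κ * ℓ ^ d) := by rw [mul_pow]; ring
      _ ≤ u * (Real.log n) := by
        have h4 : Real.log κ ≤ Real.log (64 * (1 + 1 / ρ) * (d + 1) * ℓ) :=
          Real.log_le_log (by linarith) hκ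
        have h5 : Real.log κ * ℓ ^ d ≤ Real.log n :=
          (mul_le_mul_of_nonneg_right h4 (by positivity)).trans hlog
        exact mul_le_mul (pow_le_of_le_one hu0.le hu1 hd) h5 (by positivity) hu0.le
  have hκpow : κ ^ (l.map (· + 2)).prod ≤ (n : ℝ) ^ u := by
    rw [← Real.exp_log (show 0 < κ by linarith), ← Real.exp_nat_mul, Real.rpow_def_of_pos hn0]
    apply Real.exp_le_exp.mpr
    linarith
  calc (n : ℝ) ^ (2 * ε / (3 * d)) = n * ((n : ℝ) ^ u)⁻¹ := by
        rw [← Real.rpow_neg hn0.le]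
        nth_rewrite 2 [← Real.rpow_one (n : ℝ)]
        rw [← Real.rpow_add hn0]
        congr 1
        rw [hu]; ring
    _ ≤ _ := by gcongr

/-! ### The lower bound -/

/-- The lower bound for all `n` that are large enough. -/
theorem measureReal_maxLoad_lt {d n : ℕ} [NeZero d] {ρ ε : ℝ} (hρ : 0 < ρ)
    (hlarge : IsLarge d ρ n) (hε : 1 / Real.log (Real.log n) ≤ ε)
    (T : ThinningProcess.{u, v} d n) :
    T.P.real {ω | (T.MaxLoad ⌊ρ * n⌋₊ ω : ℝ) < (d - ε) * ell d n} <
      Real.exp (-(n : ℝ) ^ (ε / (3 * d))) := by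
  have hd : d ≠ 0 := NeZero.ne d
  have hd0 : (0 : ℝ) < d := by exact_mod_cast Nat.pos_of_ne_zero hd
  have hd1 : (1 : ℝ) ≤ d := by exact_mod_cast Nat.one_le_iff_ne_zero.mpr hd
  have hy := hlarge.one_le_loglog
  have hell := hlarge.loglog_le_ell
  have hL := hlarge.le_log
  have hwlog := hlarge.log_le_exp
  set y := Real.log (Real.log n) with hydef
  have hy0 : 0 < y := by linarith
  have hell1 : 1 ≤ ell d n := by nlinarith
  rcases le_or_gt (d : ℝ) ε with hdε | hεd
  · -- the event is empty
    have : {ω | (T.MaxLoad ⌊ρ * n⌋₊ ω : ℝ) < (d - ε) * ell d n} = ∅ := by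
      ext ω
      simp only [Set.mem_ofPred_eq, Set.mem_empty_iff_false, iff_false, not_lt]
      exact (mul_nonpos_of_nonpos_of_nonneg (by linarith) (by linarith)).trans (Nat.cast_nonneg _)
    rw [this, measureReal_empty]
    exact Real.exp_pos _
  have hε0 : 0 < ε := lt_of_lt_of_le (by positivity) hε
  have hn : 0 < n := by
    rcases Nat.eq_zero_or_pos n with h | h
    · rw [h] at hL; norm_num at hL
    · exact h
  have hn0 : (0 : ℝ) < n := by exact_mod_cast hn
  have hn1 : (1 : ℝ) ≤ n := by exact_mod_cast hn
  set M : ℕ := ⌈(d - ε) * ell d n⌉₊ with hM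
  have hpos : 0 < (d - ε) * ell d n := mul_pos (by linarith) (by linarith)
  have hM0 : 0 < M := Nat.ceil_pos.mpr hpos
  have hM1 : (1 : ℝ) ≤ M := by exact_mod_cast hM0
  have hMle : (M : ℝ) ≤ (d + 1) * ell d n := by
    have := (Nat.ceil_lt_add_one hpos.le).le
    nlinarith
  set κ : ℝ := 64 * (1 + 1 / ρ) * M with hκ
  have hρ1 : 0 < 1 / ρ := by positivity
  have hκ64 : 64 * (M : ℝ) ≤ κ := by rw [hκ]; nlinarith
  set w : ℝ := (n : ℝ) ^ (ε / (3 * d)) with hw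
  have hwL : Real.log n ≤ w := by
    refine hwlog.trans ?_
    rw [hw, Real.rpow_def_of_pos hn0]
    apply Real.exp_le_exp.mpr
    calc Real.log n / (3 * d * y) = Real.log n * ((1 / y) / (3 * d)) := by field_simp
      _ ≤ _ := by gcongr
  have hq : (n : ℝ) ^ (2 * ε / (3 * d)) = w ^ 2 := by
    rw [hw, ← Real.rpow_natCast, ← Real.rpow_mul hn0.le]
    congr 1
    push_cast
    ring
  have hw64 : 64 ≤ w := hL.trans hwL
  have hsub : {ω | (T.MaxLoad ⌊ρ * n⌋₊ ω : ℝ) < (d - ε) * ell d n} ⊆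
      {ω | ¬ Typical T.strategy (T.Z ω) (T.X ω) ⌊ρ * n⌋₊ M (w ^ 2)} := by
    intro ω hω htyp
    simp only [Set.mem_ofPred_eq] at hω
    have hT : 32 * M * n ≤ ⌊ρ * n⌋₊ * κ := by
      have h1 := Nat.lt_floor_add_one (ρ * n)
      have h2 := hlarge.two_le
      have h3 : ρ * n / 2 ≤ (⌊ρ * n⌋₊ : ℝ) := by linarith
      calc 32 * M * n = ρ * n / 2 * (64 * (1 / ρ) * M) := by field_simp; ring
        _ ≤ ⌊ρ * n⌋₊ * κ := by
          rw [hκ]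
          gcongr
          linarith
    have hle : M ≤ T.MaxLoad ⌊ρ * n⌋₊ ω := by
      refine le_maxLoad_of_typical T.strategy (T.Z ω) (T.X ω) hM0 hn (κ := κ) (q := w ^ 2)
        (by linarith) (by linarith) (by nlinarith) hT htyp fun l hl hlM => ?_
      rw [← hq]
      refine rpow_le_of_isLarge hd hlarge hε hεd (by linarith) ?_ l hl (Nat.lt_ceil.mp hlM).le
      rw [hκ, mul_assoc _ ((d : ℝ) + 1)]
      gcongr
    have hle' : (M : ℝ) ≤ T.MaxLoad ⌊ρ * n⌋₊ ω := by exact_mod_cast hle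
    exact absurd hω (not_lt.mpr ((Nat.le_ceil _).trans hle'))
  refine (measureReal_mono hsub (measure_ne_top _ _)).trans_lt ?_
  refine (T.measureReal_not_typical_le hn _ M (q := w ^ 2) (by nlinarith)).trans_lt ?_
  -- the number of conditions is polynomial in `n`, and `w ≥ log n`
  have hfloor : (⌊ρ * n⌋₊ : ℝ) ≤ ρ * n := Nat.floor_le (by positivity)
  have hcount : (⌊ρ * n⌋₊ + 1 : ℝ) * M * (n + 1) * d < (n : ℝ) ^ 4 := by
    calc (⌊ρ * n⌋₊ + 1 : ℝ) * M * (n + 1) * d ≤ ((ρ + 1) * n) * n * (2 * n) * d := by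
          gcongr
          · linarith
          · exact_mod_cast hMle.trans hlarge.ell_le
          · linarith
      _ = (2 * d * (ρ + 1)) * (n : ℝ) ^ 3 := by ring
      _ < n * (n : ℝ) ^ 3 := by
        have := hlarge.lt_self
        gcongr
      _ = (n : ℝ) ^ 4 := by ring
  calc (⌊ρ * n⌋₊ + 1 : ℝ) * M * (n + 1) * d * Real.exp (-(w ^ 2 / 8))
      < (n : ℝ) ^ 4 * Real.exp (-(w ^ 2 / 8)) := by gcongr
    _ = Real.exp (4 * Real.log n - w ^ 2 / 8) := by
        rw [sub_eq_add_neg, Real.exp_add]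
        congr 1
        rw [show (4 : ℝ) = (4 : ℕ) by norm_num, Real.exp_nat_mul, Real.exp_log hn0]
    _ ≤ Real.exp (-w) := by
        apply Real.exp_le_exp.mpr
        nlinarith

end Thinning

theorem proposition4p1 :
    (∀ (d : ℕ) [NeZero d] (ρ : ℝ), 0 < ρ → ∀ ε : ℝ, 0 < ε →
      ∃ n₀ : ℕ, ∀ n : ℕ, n₀ < n → ∀ T : Thinning.ThinningProcess.{u, v} d n,
        T.P.real {ω | (T.MaxLoad ⌊ρ * n⌋₊ ω : ℝ) < (d - ε) * Thinning.ell d n}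
          < Real.exp (-(n : ℝ) ^ (ε / (3 * d)))) ∧
    ∃ C : ℝ, 0 < C ∧
      (∀ (d : ℕ) [NeZero d] (ρ : ℝ), 0 < ρ →
        ∃ n₀ : ℕ, ∀ n : ℕ, n₀ < n → ∀ ε : ℝ, C / Real.log (Real.log n) ≤ ε →
          ∀ T : Thinning.ThinningProcess.{u, v} d n,
            T.P.real {ω | (T.MaxLoad ⌊ρ * n⌋₊ ω : ℝ) < (d - ε) * Thinning.ell d n}
              < Real.exp (-(n : ℝ) ^ (ε / (3 * d)))) ∧
      (∀ (d : ℕ) [NeZero d] (ρ : ℝ), 0 < ρ → ∀ δ : ℝ, 0 < δ →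
        ∃ n₀ : ℕ, ∀ n : ℕ, n₀ < n → ∀ T : Thinning.ThinningProcess.{u, v} d n,
          1 - δ < T.P.real {ω |
            (d - C / Real.log (Real.log n)) * Thinning.ell d n ≤ (T.MaxLoad ⌊ρ * n⌋₊ ω : ℝ)}) := by
  have hlog : Filter.Tendsto (fun n : ℕ => Real.log n) Filter.atTop Filter.atTop :=
    Real.tendsto_log_atTop.comp tendsto_natCast_atTop_atTop
  refine ⟨fun d _ ρ hρ ε hε => ?_, 1, one_pos, fun d _ ρ hρ => ?_, fun d _ ρ hρ δ hδ => ?_⟩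
  · have hinv : ∀ᶠ n : ℕ in Filter.atTop, 1 / ε ≤ Real.log (Real.log n) :=
      (Real.tendsto_log_atTop.comp hlog).eventually_ge_atTop _
    obtain ⟨n₀, h⟩ := Filter.eventually_atTop.mp
      ((Thinning.eventually_isLarge d (NeZero.ne d) hρ).and hinv)
    refine ⟨n₀, fun n hn T => ?_⟩
    obtain ⟨h1, h2⟩ := h n hn.le
    refine Thinning.measureReal_maxLoad_lt hρ h1 ?_ T
    have := h1.one_le_loglog
    rw [div_le_iff₀ hε] at h2
    rw [div_le_iff₀ (by linarith)]
    linarith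
  · obtain ⟨n₀, h⟩ := Filter.eventually_atTop.mp (Thinning.eventually_isLarge d (NeZero.ne d) hρ)
    exact ⟨n₀, fun n hn ε hε T => Thinning.measureReal_maxLoad_lt hρ (h n hn.le) hε T⟩
  · have hδ' : ∀ᶠ n : ℕ in Filter.atTop, -Real.log δ ≤ Real.log n :=
      hlog.eventually_ge_atTop _
    obtain ⟨n₀, h⟩ := Filter.eventually_atTop.mp
      ((Thinning.eventually_isLarge d (NeZero.ne d) hρ).and hδ')
    refine ⟨n₀, fun n hn T => ?_⟩
    obtain ⟨h1, h2⟩ := h n hn.le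
    have hlt := Thinning.measureReal_maxLoad_lt hρ h1 le_rfl T
    set S := {ω | (T.MaxLoad ⌊ρ * n⌋₊ ω : ℝ) <
      (d - 1 / Real.log (Real.log n)) * Thinning.ell d n} with hS
    have hcompl : {ω | (d - 1 / Real.log (Real.log n)) * Thinning.ell d n ≤
        (T.MaxLoad ⌊ρ * n⌋₊ ω : ℝ)} = Sᶜ := by
      ext ω; simp [hS]
    have hle : Real.exp (-(n : ℝ) ^ (1 / Real.log (Real.log n) / (3 * d))) ≤ δ := by
      rw [← Real.le_log_iff_exp_le hδ]
      have hL := h1.le_log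
      have hn0 : (0 : ℝ) < n := by
        rcases Nat.eq_zero_or_pos n with h | h
        · rw [h] at hL; norm_num at hL
        · exact_mod_cast h
      have h3 := h1.log_le_exp
      have h4 : Real.log n / (3 * d * Real.log (Real.log n)) =
          Real.log n * (1 / Real.log (Real.log n) / (3 * d)) := by
        rw [div_div, mul_one_div, mul_comm (Real.log (Real.log n))]
      rw [h4, ← Real.rpow_def_of_pos hn0] at h3
      linarith
    have hunion : 1 ≤ T.P.real S + T.P.real Sᶜ := by
      rw [← probReal_univ (μ := T.P), ← Set.union_compl_self S]
      exact measureReal_union_le S Sᶜ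
    rw [hcompl]
    linarith
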